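/- Let $k$ be a field. For a commutative $k$-algebra $A$ let $A^\circ$ be its finite dual coalgebra: the space of linear functionals $A\to k$ that vanish on an ideal of finite codimension, with comultiplication the restriction $A^\circ\to A^\circ\otimes A^\circ$ of the transpose of the multiplication of $A$ and counit $\varphi\mapsto\varphi(1)$. For a $k$-scheme $X$ let $$\operatorname{Dist}(X)=\varinjlim_{S}\Gamma(S,\mathcal O_S)^*$$ be the direct limit of dual coalgebras over the closed subschemes $S\subseteq X$ that are finite over $k$. It is a functor of $X$: a morphism $f\colon X\to Y$ of $k$-schemes maps $\Gamma(S,\mathcal O_S)^*$ to $\Gamma(S',\mathcal O_{S'})^*$, where $S'$ is the scheme-theoretic image of $S$ in $Y$ (which is again finite over $k$), by the transpose of $\Gamma(S',\mathcal O_{S'})\to\Gamma(S,\mathcal O_S)$. For $x\in X$ put $\operatorname{Dist}(X,x)=(\mathcal O_{X,x})^\circ$. Let $X_0$ be the set of closed points of $X$ and $\operatorname{fin}(X)=\{x\in X\mid[\kappa(x):k]<\infty\}$. For each $x\in X$ the canonical morphism $\operatorname{Spec}\mathcal O_{X,x}\to X$ induces a coalgebra homomorphism $\operatorname{Dist}(X,x)=(\mathcal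 O_{X,x})^\circ\cong\operatorname{Dist}(\operatorname{Spec}\mathcal O_{X,x})\to\operatorname{Dist}(X)$, where the isomorphism is the canonical one, under which $\varphi\in\Gamma(S,\mathcal O_S)^*$ corresponds to the composite $\mathcal O_{X,x}\to\Gamma(S,\mathcal O_S)\xrightarrow{\varphi}k$. Then, for every $k$-scheme $X$: 1. The homomorphisms above induce an isomorphism of coalgebras $$\bigoplus_{x\in\operatorname{fin}(X)}\operatorname{Dist}(X,x)=\bigoplus_{x\in\operatorname{fin}(X)}(\mathcal O_{X,x})^\circ\;\cong\;\operatorname{Dist}(X).$$ 2. This isomorphism is natural in $X$: for a morphism $f\colon X\to Y$ of $k$-schemes it commutes with $\operatorname{Dist}(f)$ and with the homomorphism $\bigoplus_{x\in\operatorname{fin}(X)}(\mathcal O_{X,x})^\circ\to\bigoplus_{y\in\operatorname{fin}(Y)}(\mathcal O_{Y,y})^\circ$ whose components are the duals $(\mathcal O_{X,x})^\circ\to(\mathcal O_{Y,f(x)})^\circ$ of the homomorphisms $\mathcal O_{Y,f(x)}\to\mathcal O_{X,x}$. 3. One has $\operatorname{fin}(X)\subseteq X_0$ and $(\mathcal O_{X,x})^\circ=0$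 for $x\notin\operatorname{fin}(X)$, and the homomorphisms above also induce an isomorphism of coalgebras from Takeuchi's underlying coalgebra $\bigoplus_{x\in X_0}\operatorname{Dist}(X,x)$ to $\operatorname{Dist}(X)$. -/

import Mathlib

open CategoryTheory AlgebraicGeometry TensorProduct

universe u

namespace SchemeDist

noncomputable section LinearAlgebra

variable {k : Type*} [Field k]

/-- The product functional `f ⊗ g : D ⊗ E → k`, `d ⊗ e ↦ f d * g e`. -/
def evT {D E : Type*} [AddCommMonoid D] [Module k D] [AddCommMonoid E] [Module k E]
    (f : D →ₗ[k] k) (g : E →ₗ[k] k) : D ⊗[k] E →ₗ[k] k :=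
  LinearMap.mul' k k ∘ₗ TensorProduct.map f g

theorem evT_tmul {D E : Type*} [AddCommMonoid D] [Module k D] [AddCommMonoid E] [Module k E]
    (f : D →ₗ[k] k) (g : E →ₗ[k] k) (d : D) (e : E) : evT f g (d ⊗ₜ e) = f d * g e := by
  simp [evT]

theorem evT_comp_map {D E D' E' : Type*} [AddCommMonoid D] [Module k D] [AddCommMonoid E]
    [Module k E] [AddCommMonoid D'] [Module k D'] [AddCommMonoid E'] [Module k E']
    (f : D →ₗ[k] k) (g : E →ₗ[k] k) (p : D' →ₗ[k] D) (q : E' →ₗ[k] E) (t : D' ⊗[k] E') :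
    evT f g (TensorProduct.map p q t) = evT (f ∘ₗ p) (g ∘ₗ q) t := by
  simp only [evT, LinearMap.comp_apply, TensorProduct.map_comp]

/-- Product functionals of two separating families separate the points of the tensor product. -/
theorem evT_separates {D E : Type*} [AddCommGroup D] [Module k D] [AddCommGroup E] [Module k E]
    {ι κ : Type*} (f : ι → D →ₗ[k] k) (g : κ → E →ₗ[k] k)
    (hf : ∀ d, (∀ i, f i d = 0) → d = 0) (hg : ∀ e, (∀ j, g j e = 0) → e = 0)
    (t : D ⊗[k] E) (ht : ∀ i j, evT (f i) (g j) t = 0) : t = 0 := by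
  classical
  let b := Module.Basis.ofVectorSpace k D
  obtain ⟨c, rfl⟩ := (TensorProduct.equivFinsuppOfBasisLeft (N := E) b).symm.surjective t
  suffices h : c = 0 by simp [h]
  ext x
  refine hg _ fun j => ?_
  have key : ∑ y ∈ c.support, g j (c y) • b y = 0 := by
    refine hf _ fun i => ?_
    have := ht i j
    rw [TensorProduct.equivFinsuppOfBasisLeft_symm_apply, Finsupp.sum, map_sum] at this
    rw [map_sum, ← this]
    refine Finset.sum_congr rfl fun y _ => ?_
    rw [evT_tmul, map_smul, smul_eq_mul, mul_comm]
  by_cases hx : x ∈ c.support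
  · exact linearIndependent_iff'.mp b.linearIndependent _ _ key x hx
  · simp [Finsupp.notMem_support_iff.mp hx]

theorem evT_ext {D E : Type*} [AddCommGroup D] [Module k D] [AddCommGroup E] [Module k E]
    {ι κ : Type*} (f : ι → D →ₗ[k] k) (g : κ → E →ₗ[k] k)
    (hf : ∀ d, (∀ i, f i d = 0) → d = 0) (hg : ∀ e, (∀ j, g j e = 0) → e = 0)
    {s t : D ⊗[k] E} (ht : ∀ i j, evT (f i) (g j) s = evT (f i) (g j) t) : s = t :=
  sub_eq_zero.mp <| evT_separates f g hf hg _ fun i j => by rw [map_sub, ht, sub_self]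

/-- Let the space `D` be separated by functionals `ev a` indexed by an algebra `A`. A
comultiplication with `(ev a ⊗ ev b) ∘ Δ = ev (a * b)` together with the counit `ev 1` is
coassociative and counital. -/
@[reducible] def coalgebraOfEv {A D : Type*} [Monoid A] [AddCommGroup D] [Module k D]
    [CoalgebraStruct k D] (ev : A → D →ₗ[k] k) (hev : ∀ d, (∀ a, ev a d = 0) → d = 0)
    (hΔ : ∀ a b d, evT (ev a) (ev b) (CoalgebraStruct.comul (R := k) d) = ev (a * b) d)
    (hε : CoalgebraStruct.counit (R := k) = ev 1) :
    Coalgebra k D where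
  coassoc := by
    ext d
    refine evT_ext ev (fun p : A × A => evT (ev p.1) (ev p.2)) hev
      (fun t ht => evT_separates ev ev hev hev t fun i j => ht (i, j)) fun a p => ?_
    have h1 : evT (ev a) (evT (ev p.1) (ev p.2)) ∘ₗ (TensorProduct.assoc k D D D).toLinearMap
        = evT (evT (ev a) (ev p.1)) (ev p.2) := by
      ext x y z; simp [evT, mul_assoc]
    have h2 := LinearMap.congr_fun h1 (CoalgebraStruct.comul.rTensor D (CoalgebraStruct.comul (R := k) d))
    have h3 : evT (ev a) (ev p.1) ∘ₗ CoalgebraStruct.comul = ev (a * p.1) := LinearMap.ext (hΔ _ _)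
    have h4 : evT (ev p.1) (ev p.2) ∘ₗ CoalgebraStruct.comul = ev (p.1 * p.2) := LinearMap.ext (hΔ _ _)
    simp only [LinearMap.comp_apply, LinearEquiv.coe_coe] at h2 ⊢
    rw [h2, LinearMap.rTensor, evT_comp_map, LinearMap.lTensor, evT_comp_map, h3, h4,
      LinearMap.comp_id, LinearMap.comp_id, hΔ, hΔ, mul_assoc]
  rTensor_counit_comp_comul := by
    ext d
    refine evT_ext (fun _ : Unit => LinearMap.id) ev (fun d hd => hd ()) hev fun _ a => ?_
    rw [LinearMap.comp_apply, LinearMap.rTensor, evT_comp_map, hε, LinearMap.id_comp,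
      LinearMap.comp_id, hΔ, one_mul, TensorProduct.mk_apply, evT_tmul]
    simp
  lTensor_counit_comp_comul := by
    ext d
    refine evT_ext ev (fun _ : Unit => LinearMap.id) hev (fun d hd => hd ()) fun a _ => ?_
    rw [LinearMap.comp_apply, LinearMap.lTensor, evT_comp_map, hε, LinearMap.id_comp,
      LinearMap.comp_id, hΔ, mul_one, LinearMap.flip_apply, TensorProduct.mk_apply, evT_tmul]
    simp

end LinearAlgebra

noncomputable section Duals

variable {k : Type*} [Field k]

section DualCoalgebra

variable {A : Type*} [CommRing A] [Algebra k A]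

theorem dual_separates (d : Module.Dual k A) (h : ∀ a, Module.Dual.eval k A a d = 0) : d = 0 :=
  LinearMap.ext h

/-- The dual coalgebra `A^*` of a finite-dimensional algebra: the comultiplication is the
transpose of the multiplication, followed by `(A ⊗ A)^* ≅ A^* ⊗ A^*`; the counit is `φ ↦ φ 1`. -/
instance dualCoalgebraStruct [Module.Finite k A] : CoalgebraStruct k (Module.Dual k A) where
  comul := (dualDistribEquiv k A A).symm.toLinearMap ∘ₗ (LinearMap.mul' k A).dualMap
  counit := Module.Dual.eval k A 1

theorem evT_comul_dual [Module.Finite k A] (a b : A) (φ : Module.Dual k A) :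
    evT (Module.Dual.eval k A a) (Module.Dual.eval k A b) (CoalgebraStruct.comul (R := k) φ)
      = φ (a * b) := by
  have h : evT (Module.Dual.eval k A a) (Module.Dual.eval k A b)
      = Module.Dual.eval k _ (a ⊗ₜ[k] b) ∘ₗ (dualDistribEquiv k A A).toLinearMap := by
    ext f g; simp [evT, dualDistribEquiv, dualDistribEquivOfBasis]
  rw [h]
  have := (dualDistribEquiv k A A).apply_symm_apply ((LinearMap.mul' k A).dualMap φ)
  exact (LinearMap.congr_fun this (a ⊗ₜ b)).trans (by simp)

instance dualCoalgebra [Module.Finite k A] : Coalgebra k (Module.Dual k A) :=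
  coalgebraOfEv (fun a : A => Module.Dual.eval k A a) dual_separates evT_comul_dual rfl

/-- The transpose of an algebra homomorphism, as a homomorphism of dual coalgebras. -/
def dualMap {B : Type*} [CommRing B] [Algebra k B] [Module.Finite k A] [Module.Finite k B]
    (f : A →ₐ[k] B) : Module.Dual k B →ₗc[k] Module.Dual k A where
  toLinearMap := f.toLinearMap.dualMap
  counit_comp := by
    ext φ
    simp [CoalgebraStruct.counit]
  map_comp_comul := by
    refine LinearMap.ext fun φ => ?_
    refine evT_ext (fun a : A => Module.Dual.eval k A a) (fun a : A => Module.Dual.eval k A a)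
      dual_separates dual_separates fun a b => ?_
    rw [LinearMap.comp_apply, LinearMap.comp_apply, evT_comul_dual, evT_comp_map]
    refine (evT_comul_dual (f a) (f b) φ).trans ?_
    simp

end DualCoalgebra

section FiniteDual

variable (k) in
/-- The finite dual `A°` as a subspace of `A^*`: the functionals that vanish on an ideal of
finite codimension. -/
def finiteDualSubmodule (A : Type*) [CommRing A] [Algebra k A] : Submodule k (Module.Dual k A) where
  carrier := {φ | ∃ I : Ideal A, Module.Finite k (A ⧸ I) ∧ ∀ a ∈ I, φ a = 0}
  zero_mem' := ⟨⊤, inferInstance, fun _ _ => rfl⟩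
  smul_mem' := by
    rintro c φ ⟨I, hI, h⟩
    exact ⟨I, hI, fun a ha => by simp [h a ha]⟩
  add_mem' := by
    rintro φ ψ ⟨I, hI, h⟩ ⟨J, hJ, h'⟩
    refine ⟨I ⊓ J, ?_, fun a ha => by simp [h a ha.1, h' a ha.2]⟩
    let g : A →ₐ[k] (A ⧸ I) × (A ⧸ J) :=
      (Ideal.Quotient.mkₐ k I).prod (Ideal.Quotient.mkₐ k J)
    have hg : ∀ a, g a = 0 ↔ a ∈ I ⊓ J := fun a => by
      simp [g, Prod.ext_iff, Ideal.Quotient.eq_zero_iff_mem]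
    refine Module.Finite.of_injective
      (Ideal.Quotient.liftₐ (I ⊓ J) g fun a ha => (hg a).mpr ha).toLinearMap ?_
    refine (injective_iff_map_eq_zero
      (Ideal.Quotient.liftₐ (I ⊓ J) g fun a ha => (hg a).mpr ha)).mpr fun x hx => ?_
    obtain ⟨a, rfl⟩ := Ideal.Quotient.mk_surjective x
    exact Ideal.Quotient.eq_zero_iff_mem.mpr ((hg a).mp hx)

variable (k) in
/-- The finite dual `A°` of a commutative `k`-algebra `A`. -/
def FiniteDual (A : Type*) [CommRing A] [Algebra k A] : Type _ := finiteDualSubmodule k A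

variable {A : Type*} [CommRing A] [Algebra k A]

instance : AddCommGroup (FiniteDual k A) := inferInstanceAs (AddCommGroup (finiteDualSubmodule k A))

instance : Module k (FiniteDual k A) := inferInstanceAs (Module k (finiteDualSubmodule k A))

variable (k A) in
/-- The inclusion `A° → A^*`. -/
def FiniteDual.incl : FiniteDual k A →ₗ[k] Module.Dual k A := (finiteDualSubmodule k A).subtype

/-- A linear map to `A^*` with image in `A°`, as a map to `A°`. -/
def FiniteDual.codRestrict {V : Type*} [AddCommGroup V] [Module k V] (f : V →ₗ[k] Module.Dual k A)
    (hf : ∀ v, f v ∈ finiteDualSubmodule k A) : V →ₗ[k] FiniteDual k A :=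
  LinearMap.codRestrict (finiteDualSubmodule k A) f hf

theorem FiniteDual.incl_mem (φ : FiniteDual k A) :
    FiniteDual.incl k A φ ∈ finiteDualSubmodule k A := φ.2

theorem FiniteDual.incl_injective : Function.Injective (FiniteDual.incl k A) :=
  Subtype.val_injective

/-- Evaluation at `a`, as a functional on the finite dual. -/
def FiniteDual.ev (a : A) : FiniteDual k A →ₗ[k] k :=
  Module.Dual.eval k A a ∘ₗ FiniteDual.incl k A

theorem FiniteDual.ev_apply (a : A) (φ : FiniteDual k A) :
    FiniteDual.ev a φ = FiniteDual.incl k A φ a := rfl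

theorem FiniteDual.separates (d : FiniteDual k A) (h : ∀ a : A, FiniteDual.ev a d = 0) : d = 0 :=
  FiniteDual.incl_injective (LinearMap.ext h)

theorem FiniteDual.tensor_ext {s t : FiniteDual k A ⊗[k] FiniteDual k A}
    (h : ∀ a b : A, evT (FiniteDual.ev a) (FiniteDual.ev b) s
      = evT (FiniteDual.ev a) (FiniteDual.ev b) t) : s = t :=
  evT_ext (D := FiniteDual k A) (E := FiniteDual k A) (fun a : A => FiniteDual.ev a)
    (fun a : A => FiniteDual.ev a) FiniteDual.separates FiniteDual.separates h

variable (k A) in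
/-- The natural map `A° ⊗ A° → (A ⊗ A)^*`. -/
def FiniteDual.distrib : FiniteDual k A ⊗[k] FiniteDual k A →ₗ[k] Module.Dual k (A ⊗[k] A) :=
  dualDistrib k A A ∘ₗ TensorProduct.map (FiniteDual.incl k A) (FiniteDual.incl k A)

theorem FiniteDual.distrib_apply (t : FiniteDual k A ⊗[k] FiniteDual k A) (a b : A) :
    FiniteDual.distrib k A t (a ⊗ₜ b) = evT (FiniteDual.ev a) (FiniteDual.ev b) t := by
  have h : Module.Dual.eval k _ (a ⊗ₜ[k] b) ∘ₗ FiniteDual.distrib k A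
      = evT (FiniteDual.ev a) (FiniteDual.ev b) := by
    ext f g; simp [evT, FiniteDual.distrib, FiniteDual.ev]
  exact LinearMap.congr_fun h t

theorem FiniteDual.distrib_injective : Function.Injective (FiniteDual.distrib k A) := by
  intro s t h
  refine FiniteDual.tensor_ext fun a b => ?_
  rw [← FiniteDual.distrib_apply, h, FiniteDual.distrib_apply]

theorem comp_mem_finiteDual {B : Type*} [CommRing B] [Algebra k B] (f : A →ₐ[k] B)
    (φ : Module.Dual k B) (hφ : φ ∈ finiteDualSubmodule k B) :
    φ ∘ₗ f.toLinearMap ∈ finiteDualSubmodule k A := by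
  obtain ⟨I, hI, h⟩ := hφ
  refine ⟨I.comap f, ?_, fun a ha => h _ ha⟩
  exact Module.Finite.of_injective (Ideal.quotientMapₐ I f le_rfl).toLinearMap
    (Ideal.quotientMap_injective (f := (f : A →+* B)))

theorem mem_finiteDual_of_finite [Module.Finite k A] (φ : Module.Dual k A) :
    φ ∈ finiteDualSubmodule k A :=
  ⟨⊥, inferInstance, fun a ha => by rw [Ideal.mem_bot.mp ha, map_zero]⟩

/-- The transpose `m^*` of the multiplication maps `A°` into `A° ⊗ A°`. -/
theorem FiniteDual.mul_mem_range (φ : FiniteDual k A) :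
    (LinearMap.mul' k A).dualMap (FiniteDual.incl k A φ) ∈ LinearMap.range (FiniteDual.distrib k A) := by
  obtain ⟨I, hI, h⟩ := φ.incl_mem
  rw [LinearMap.mem_range]
  let ψ : Module.Dual k (A ⧸ I) := (I.restrictScalars k).liftQ (FiniteDual.incl k A φ) (fun a ha => h a ha)
  let q : Module.Dual k (A ⧸ I) →ₗ[k] FiniteDual k A :=
    FiniteDual.codRestrict (Ideal.Quotient.mkₐ k I).toLinearMap.dualMap fun χ =>
      comp_mem_finiteDual (Ideal.Quotient.mkₐ k I) χ (mem_finiteDual_of_finite χ)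
  refine ⟨TensorProduct.map q q (CoalgebraStruct.comul (R := k) ψ), ?_⟩
  ext a b
  refine (FiniteDual.distrib_apply _ a b).trans ?_
  rw [evT_comp_map]
  exact evT_comul_dual (Ideal.Quotient.mk I a) (Ideal.Quotient.mk I b) ψ

/-- The comultiplication of `A°` is the unique map `Δ : A° → A° ⊗ A°` whose composite with the
natural injection `A° ⊗ A° → (A ⊗ A)^*` is the transpose of the multiplication; the counit is
`φ ↦ φ 1`. -/
instance FiniteDual.coalgebraStruct : CoalgebraStruct k (FiniteDual k A) where
  comul := (LinearEquiv.ofInjective _ FiniteDual.distrib_injective).symm.toLinearMap ∘ₗ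
    ((LinearMap.mul' k A).dualMap ∘ₗ FiniteDual.incl k A).codRestrict
      (LinearMap.range (FiniteDual.distrib k A)) FiniteDual.mul_mem_range
  counit := FiniteDual.ev 1

theorem FiniteDual.evT_comul (a b : A) (φ : FiniteDual k A) :
    evT (FiniteDual.ev a) (FiniteDual.ev b) (CoalgebraStruct.comul (R := k) φ)
      = FiniteDual.ev (a * b) φ := by
  rw [← FiniteDual.distrib_apply]
  have := LinearEquiv.ofInjective_symm_apply (f := FiniteDual.distrib k A) (h := FiniteDual.distrib_injective)
    (((LinearMap.mul' k A).dualMap ∘ₗ FiniteDual.incl k A).codRestrict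
      (LinearMap.range (FiniteDual.distrib k A)) FiniteDual.mul_mem_range φ)
  exact (LinearMap.congr_fun this (a ⊗ₜ b)).trans (by simp [FiniteDual.ev])

instance FiniteDual.coalgebra : Coalgebra k (FiniteDual k A) :=
  coalgebraOfEv (fun a : A => FiniteDual.ev a) FiniteDual.separates FiniteDual.evT_comul rfl

/-- An algebra homomorphism `f : A → B` induces the coalgebra homomorphism `B° → A°`,
`φ ↦ φ ∘ f`. -/
def FiniteDual.map {B : Type*} [CommRing B] [Algebra k B] (f : A →ₐ[k] B) :
    FiniteDual k B →ₗc[k] FiniteDual k A where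
  toLinearMap := FiniteDual.codRestrict (f.toLinearMap.dualMap ∘ₗ FiniteDual.incl k B)
    fun φ => comp_mem_finiteDual f _ φ.incl_mem
  counit_comp := by
    ext φ
    exact congrArg (FiniteDual.incl k B φ) (map_one f)
  map_comp_comul := by
    refine LinearMap.ext fun φ => ?_
    refine FiniteDual.tensor_ext fun a b => ?_
    rw [LinearMap.comp_apply, LinearMap.comp_apply, FiniteDual.evT_comul, evT_comp_map]
    refine (FiniteDual.evT_comul (f a) (f b) φ).trans ?_
    exact congrArg (FiniteDual.incl k B φ) (map_mul f a b).symm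

/-- For a homomorphism `f : A → B` to a finite-dimensional algebra, the coalgebra homomorphism
`B^* → A°`, `φ ↦ φ ∘ f`. -/
def FiniteDual.ofDual {B : Type*} [CommRing B] [Algebra k B] [Module.Finite k B] (f : A →ₐ[k] B) :
    Module.Dual k B →ₗc[k] FiniteDual k A where
  toLinearMap := FiniteDual.codRestrict f.toLinearMap.dualMap
    fun φ => comp_mem_finiteDual f φ (mem_finiteDual_of_finite φ)
  counit_comp := by
    ext φ
    exact congrArg φ (map_one f)
  map_comp_comul := by
    refine LinearMap.ext fun φ => ?_
    refine FiniteDual.tensor_ext fun a b => ?_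
    rw [LinearMap.comp_apply, LinearMap.comp_apply, FiniteDual.evT_comul, evT_comp_map]
    refine (evT_comul_dual (f a) (f b) φ).trans ?_
    exact congrArg φ (map_mul f a b).symm

end FiniteDual

end Duals

noncomputable section DirectLimit

open scoped Classical in
/-- The direct limit of a system of coalgebras `G i` and coalgebra homomorphisms `f i j`: the
direct limit of the underlying vector spaces. -/
def CoalgLimit {k : Type*} [Field k] {ι : Type*} [Preorder ι] {G : ι → Type*}
    [∀ i, AddCommGroup (G i)] [∀ i, Module k (G i)] [∀ i, Coalgebra k (G i)]
    (f : ∀ i j, i ≤ j → G i →ₗc[k] G j) : Type _ :=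
  Module.DirectLimit G fun i j h => (f i j h).toLinearMap

namespace CoalgLimit

variable {k : Type*} [Field k] {ι : Type*} [Preorder ι]
  {G : ι → Type*} [∀ i, AddCommGroup (G i)] [∀ i, Module k (G i)] [∀ i, Coalgebra k (G i)]
  (f : ∀ i j, i ≤ j → G i →ₗc[k] G j)

open scoped Classical in
instance : AddCommGroup (CoalgLimit f) :=
  inferInstanceAs (AddCommGroup (Module.DirectLimit G fun i j h => (f i j h).toLinearMap))

open scoped Classical in
instance : Module k (CoalgLimit f) :=
  inferInstanceAs (Module k (Module.DirectLimit G fun i j h => (f i j h).toLinearMap))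

open scoped Classical in
/-- The canonical linear maps to the direct limit. -/
def ofₗ (i : ι) : G i →ₗ[k] CoalgLimit f :=
  Module.DirectLimit.of k ι G (fun i j h => (f i j h).toLinearMap) i

open scoped Classical in
theorem ofₗ_map {i j : ι} (h : i ≤ j) (x : G i) : ofₗ f j (f i j h x) = ofₗ f i x :=
  Module.DirectLimit.of_f (f := fun i j h => (f i j h).toLinearMap) (hij := h)

open scoped Classical in
/-- The linear map out of the direct limit given by a compatible family. -/
def liftₗ {P : Type*} [AddCommGroup P] [Module k P] (g : ∀ i, G i →ₗ[k] P)
    (hg : ∀ i j (h : i ≤ j) x, g j (f i j h x) = g i x) : CoalgLimit f →ₗ[k] P :=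
  Module.DirectLimit.lift k ι G (fun i j h => (f i j h).toLinearMap) g hg

open scoped Classical in
theorem liftₗ_comp_ofₗ {P : Type*} [AddCommGroup P] [Module k P] (g : ∀ i, G i →ₗ[k] P)
    (hg : ∀ i j (h : i ≤ j) x, g j (f i j h x) = g i x) (i : ι) :
    liftₗ f g hg ∘ₗ ofₗ f i = g i :=
  LinearMap.ext fun x => Module.DirectLimit.lift_of (f := fun i j h => (f i j h).toLinearMap) g hg x

open scoped Classical in
theorem hom_extₗ {P : Type*} [AddCommMonoid P] [Module k P] {p q : CoalgLimit f →ₗ[k] P}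
    (h : ∀ i, p ∘ₗ ofₗ f i = q ∘ₗ ofₗ f i) : p = q :=
  Module.DirectLimit.hom_ext (f := fun i j h => (f i j h).toLinearMap) h

open scoped Classical in
theorem liftₗ_injective [IsDirectedOrder ι] {P : Type*} [AddCommGroup P] [Module k P]
    (g : ∀ i, G i →ₗ[k] P) (hg : ∀ i j (h : i ≤ j) x, g j (f i j h x) = g i x)
    (hinj : ∀ i, Function.Injective (g i)) : Function.Injective (liftₗ f g hg) :=
  Module.DirectLimit.lift_injective (f := fun i j h => (f i j h).toLinearMap) g hg hinj

open scoped Classical in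
theorem exists_of [Nonempty ι] [IsDirectedOrder ι] (x : CoalgLimit f) : ∃ i y, ofₗ f i y = x :=
  Module.DirectLimit.exists_of (f := fun i j h => (f i j h).toLinearMap) x

/-- The coalgebra structure of the direct limit: the one that makes the canonical maps coalgebra
homomorphisms. -/
instance : CoalgebraStruct k (CoalgLimit f) where
  comul := liftₗ f (fun i => TensorProduct.map (ofₗ f i) (ofₗ f i) ∘ₗ CoalgebraStruct.comul) (by
    intro i j h x
    have h1 := LinearMap.congr_fun (f i j h).map_comp_comul x
    have h2 : ofₗ f j ∘ₗ (f i j h).toLinearMap = ofₗ f i := LinearMap.ext (ofₗ_map f h)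
    simp only [LinearMap.comp_apply] at h1 ⊢
    change TensorProduct.map (ofₗ f j) (ofₗ f j)
      (CoalgebraStruct.comul ((f i j h).toLinearMap x)) = _
    rw [← h1, ← LinearMap.comp_apply, ← TensorProduct.map_comp, h2])
  counit := liftₗ f (fun i => CoalgebraStruct.counit) fun i j h x =>
    LinearMap.congr_fun (f i j h).counit_comp x

theorem comul_comp_ofₗ (i : ι) : CoalgebraStruct.comul ∘ₗ ofₗ f i
    = TensorProduct.map (ofₗ f i) (ofₗ f i) ∘ₗ CoalgebraStruct.comul :=
  liftₗ_comp_ofₗ f _ _ i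

theorem counit_comp_ofₗ (i : ι) : CoalgebraStruct.counit ∘ₗ ofₗ f i
    = CoalgebraStruct.counit (R := k) :=
  liftₗ_comp_ofₗ f _ _ i

instance : Coalgebra k (CoalgLimit f) where
  coassoc := by
    refine hom_extₗ f fun i => ?_
    simp_rw [LinearMap.comp_assoc, comul_comp_ofₗ, ← LinearMap.comp_assoc,
      LinearMap.lTensor_comp_map, comul_comp_ofₗ, LinearMap.comp_assoc,
      ← LinearMap.comp_assoc CoalgebraStruct.comul, LinearMap.rTensor_comp_map, comul_comp_ofₗ,
      ← LinearMap.map_comp_rTensor, ← LinearMap.map_comp_lTensor, LinearMap.comp_assoc,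
      ← Coalgebra.coassoc, ← LinearMap.comp_assoc CoalgebraStruct.comul, ← LinearMap.comp_assoc,
      TensorProduct.map_map_comp_assoc_eq]
  rTensor_counit_comp_comul := by
    refine hom_extₗ f fun i => ?_
    rw [LinearMap.comp_assoc, comul_comp_ofₗ, ← LinearMap.comp_assoc, LinearMap.rTensor_comp_map,
      counit_comp_ofₗ, ← LinearMap.lTensor_comp_rTensor, LinearMap.comp_assoc,
      Coalgebra.rTensor_counit_comp_comul, LinearMap.lTensor_comp_mk]
  lTensor_counit_comp_comul := by
    refine hom_extₗ f fun i => ?_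
    rw [LinearMap.comp_assoc, comul_comp_ofₗ, ← LinearMap.comp_assoc, LinearMap.lTensor_comp_map,
      counit_comp_ofₗ, ← LinearMap.rTensor_comp_lTensor, LinearMap.comp_assoc,
      Coalgebra.lTensor_counit_comp_comul, LinearMap.rTensor_comp_flip_mk]

/-- The canonical coalgebra homomorphisms to the direct limit. -/
def of (i : ι) : G i →ₗc[k] CoalgLimit f where
  toLinearMap := ofₗ f i
  counit_comp := counit_comp_ofₗ f i
  map_comp_comul := (comul_comp_ofₗ f i).symm

theorem of_map {i j : ι} (h : i ≤ j) (x : G i) : of f j (f i j h x) = of f i x :=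
  ofₗ_map f h x

/-- The coalgebra homomorphism out of the direct limit given by a compatible family. -/
def lift {C : Type*} [AddCommGroup C] [Module k C] [Coalgebra k C] (g : ∀ i, G i →ₗc[k] C)
    (hg : ∀ i j (h : i ≤ j) x, g j (f i j h x) = g i x) : CoalgLimit f →ₗc[k] C where
  toLinearMap := liftₗ f (fun i => (g i).toLinearMap) hg
  counit_comp := by
    refine hom_extₗ f fun i => ?_
    rw [LinearMap.comp_assoc, liftₗ_comp_ofₗ, counit_comp_ofₗ, (g i).counit_comp]
  map_comp_comul := by
    refine hom_extₗ f fun i => ?_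
    rw [LinearMap.comp_assoc, LinearMap.comp_assoc, comul_comp_ofₗ, liftₗ_comp_ofₗ,
      ← LinearMap.comp_assoc, ← TensorProduct.map_comp, liftₗ_comp_ofₗ, (g i).map_comp_comul]

theorem lift_of {C : Type*} [AddCommGroup C] [Module k C] [Coalgebra k C] (g : ∀ i, G i →ₗc[k] C)
    (hg : ∀ i j (h : i ≤ j) x, g j (f i j h x) = g i x) (i : ι) (x : G i) :
    lift f g hg (of f i x) = g i x :=
  LinearMap.congr_fun (liftₗ_comp_ofₗ f _ hg i) x

end CoalgLimit

end DirectLimit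

noncomputable section DirectSum

open scoped Classical in
/-- The direct sum `⨁ i, G i` of a family of coalgebras: the finitely supported families, with the
coalgebra structure for which the inclusions of the summands are coalgebra homomorphisms. -/
def CoalgSum (k : Type*) [Field k] {ι : Type*} (G : ι → Type*) [∀ i, AddCommGroup (G i)]
    [∀ i, Module k (G i)] [∀ i, Coalgebra k (G i)] : Type _ := Π₀ i, G i

namespace CoalgSum

variable {k : Type*} [Field k] {ι : Type*} {G : ι → Type*} [∀ i, AddCommGroup (G i)]
  [∀ i, Module k (G i)] [∀ i, Coalgebra k (G i)]

instance : AddCommGroup (CoalgSum k G) := inferInstanceAs (AddCommGroup (Π₀ i, G i))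

instance : Module k (CoalgSum k G) := inferInstanceAs (Module k (Π₀ i, G i))

open scoped Classical in
instance : Coalgebra k (CoalgSum k G) := inferInstanceAs (Coalgebra k (Π₀ i, G i))

variable (k G) in
open scoped Classical in
/-- The inclusion of a summand. -/
def of (i : ι) : G i →ₗc[k] CoalgSum k G where
  toLinearMap := (DFinsupp.lsingle i : G i →ₗ[k] Π₀ i, G i)
  counit_comp := DFinsupp.counit_comp_lsingle k ι G i
  map_comp_comul := (DFinsupp.comul_comp_lsingle k ι G i).symm

open scoped Classical in
theorem hom_extₗ {P : Type*} [AddCommMonoid P] [Module k P] {p q : CoalgSum k G →ₗ[k] P}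
    (h : ∀ i, p ∘ₗ (of k G i).toLinearMap = q ∘ₗ (of k G i).toLinearMap) : p = q :=
  DFinsupp.lhom_ext' (M := G) h

open scoped Classical in
/-- The linear map out of a direct sum given by a family of linear maps. -/
def liftₗ {P : Type*} [AddCommGroup P] [Module k P] (g : ∀ i, G i →ₗ[k] P) : CoalgSum k G →ₗ[k] P :=
  (DFinsupp.lsum k g : (Π₀ i, G i) →ₗ[k] P)

open scoped Classical in
theorem liftₗ_comp_of {P : Type*} [AddCommGroup P] [Module k P] (g : ∀ i, G i →ₗ[k] P) (i : ι) :
    liftₗ g ∘ₗ (of k G i).toLinearMap = g i :=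
  LinearMap.ext fun x => (DFinsupp.lsum_single k g i x :)

/-- The homomorphism out of a direct sum given by a family of coalgebra homomorphisms. -/
def lift {C : Type*} [AddCommGroup C] [Module k C] [Coalgebra k C] (g : ∀ i, G i →ₗc[k] C) :
    CoalgSum k G →ₗc[k] C where
  toLinearMap := liftₗ fun i => (g i).toLinearMap
  counit_comp := by
    refine hom_extₗ fun i => ?_
    rw [LinearMap.comp_assoc, liftₗ_comp_of, (g i).counit_comp, (of k G i).counit_comp]
  map_comp_comul := by
    refine hom_extₗ fun i => ?_
    rw [LinearMap.comp_assoc, LinearMap.comp_assoc, ← (of k G i).map_comp_comul, liftₗ_comp_of,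
      ← LinearMap.comp_assoc, ← TensorProduct.map_comp, liftₗ_comp_of, (g i).map_comp_comul]

theorem lift_of {C : Type*} [AddCommGroup C] [Module k C] [Coalgebra k C] (g : ∀ i, G i →ₗc[k] C)
    (i : ι) (x : G i) : lift g (of k G i x) = g i x :=
  LinearMap.congr_fun (liftₗ_comp_of (fun i => (g i).toLinearMap) i) x

end CoalgSum

end DirectSum

noncomputable section Schemes

variable {k : Type u} [Field k]

variable (k) in
/-- Schemes over the field `k`, that is, over `Spec k`. -/
abbrev KScheme : Type (u + 1) := Over (Spec (CommRingCat.of k))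

/-- The algebra of global sections `Γ(X, 𝒪_X)`. -/
def Sections (X : KScheme k) : Type u := Γ(X.left, ⊤)

namespace Sections

instance (X : KScheme k) : CommRing (Sections X) := inferInstanceAs (CommRing Γ(X.left, ⊤))

/-- The structure homomorphism `k → Γ(X, 𝒪_X)`. -/
def structureHom (X : KScheme k) : CommRingCat.of k ⟶ Γ(X.left, ⊤) :=
  (Scheme.ΓSpecIso (CommRingCat.of k)).inv ≫ X.hom.appTop

instance (X : KScheme k) : Algebra k (Sections X) := (structureHom X).hom.toAlgebra

theorem structureHom_comp {X Y : KScheme k} (f : X ⟶ Y) :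
    structureHom Y ≫ f.left.appTop = structureHom X := by
  rw [structureHom, Category.assoc, ← Scheme.Hom.comp_appTop, Over.w f, structureHom]

/-- Pullback of global sections along a morphism of `k`-schemes. -/
def map {X Y : KScheme k} (f : X ⟶ Y) : Sections Y →ₐ[k] Sections X where
  __ := f.left.appTop.hom
  commutes' c := congrArg (fun g => g.hom c) (structureHom_comp f)

theorem map_comp {X Y Z : KScheme k} (f : X ⟶ Y) (g : Y ⟶ Z) :
    map (f ≫ g) = (map f).comp (map g) := by
  refine AlgHom.ext fun a => ?_
  change (f ≫ g).left.appTop.hom a = f.left.appTop.hom (g.left.appTop.hom a)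
  rw [Over.comp_left, Scheme.Hom.comp_appTop]
  rfl

/-- Global sections of a scheme that is finite over `k` form a finite-dimensional algebra. -/
theorem finite (X : KScheme k) (hX : IsFinite X.hom) : Module.Finite k (Sections X) := by
  have h := X.hom.finite_appTop
  have h2 : (structureHom X).hom.Finite := by
    rw [structureHom, CommRingCat.hom_comp]
    refine h.comp (RingHom.Finite.of_surjective _ ?_)
    exact (Scheme.ΓSpecIso (CommRingCat.of k)).commRingCatIsoToRingEquiv.symm.surjective
  exact h2

end Sections

theorem toSpecΓ_structureHom (X : KScheme k) :
    X.left.toSpecΓ ≫ Spec.map (Sections.structureHom X) = X.hom := by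
  rw [Sections.structureHom, Spec.map_comp, ← Scheme.toSpecΓ_naturality_assoc,
    ← SpecMap_ΓSpecIso_hom, ← Spec.map_comp]
  simp

/-- An affine `k`-scheme with finite-dimensional algebra of global sections is finite over `k`. -/
theorem isFinite_of_affine (X : KScheme k) [IsAffine X.left] (h : Module.Finite k (Sections X)) :
    IsFinite X.hom := by
  have h2 : IsFinite (Spec.map (Sections.structureHom X)) :=
    (IsFinite.SpecMap_iff (Sections.structureHom X)).mpr h
  rw [← toSpecΓ_structureHom]
  infer_instance

/-- The set `ℱ(X)` of closed subschemes of `X`, given by their quasi-coherent ideal sheaves, that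
are finite over `k`. -/
def FiniteSub (X : KScheme k) : Type u :=
  {I : X.left.IdealSheafData // IsFinite (I.subschemeι ≫ X.hom)}

namespace FiniteSub

variable {X : KScheme k}

/-- Closed subschemes are ordered by inclusion: `S ≤ T` means that the ideal sheaf of `T` is
contained in that of `S`. -/
instance : Preorder (FiniteSub X) where
  le S T := T.1 ≤ S.1
  le_refl S := le_refl S.1
  le_trans _ _ _ h h' := le_trans h' h

/-- The closed subscheme as a `k`-scheme. -/
def scheme (S : FiniteSub X) : KScheme k := Over.mk (S.1.subschemeι ≫ X.hom)

/-- The closed immersion into `X`. -/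
def ι (S : FiniteSub X) : S.scheme ⟶ X := Over.homMk S.1.subschemeι rfl

/-- The closed immersion between closed subschemes. -/
def incl {S T : FiniteSub X} (h : S ≤ T) : S.scheme ⟶ T.scheme :=
  Over.homMk (Scheme.IdealSheafData.inclusion h) (by
    simp [scheme])

theorem incl_ι {S T : FiniteSub X} (h : S ≤ T) : incl h ≫ T.ι = S.ι := by
  ext1
  exact Scheme.IdealSheafData.inclusion_subschemeι h

instance (S : FiniteSub X) : IsFinite S.scheme.hom := S.2

instance (S : FiniteSub X) : Mono S.ι.left := inferInstanceAs (Mono S.1.subschemeι)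

instance (S : FiniteSub X) : Module.Finite k (Sections S.scheme) := Sections.finite _ S.2

theorem hom_ext {W : KScheme k} (S : FiniteSub X) {f g : W ⟶ S.scheme} (h : f ≫ S.ι = g ≫ S.ι) :
    f = g := by
  ext1
  rw [← cancel_mono S.ι.left]
  exact congrArg CommaMorphism.left h

end FiniteSub

/-- The coalgebra of distributions of finite support: the direct limit of the dual coalgebras
`Γ(S, 𝒪_S)^*` over the closed subschemes `S` of `X` that are finite over `k`. -/
abbrev Dist (X : KScheme k) : Type u :=
  CoalgLimit (ι := FiniteSub X) (G := fun S => Module.Dual k (Sections S.scheme))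
    fun _ _ h => dualMap (Sections.map (FiniteSub.incl h))

/-- The canonical map `Dist S = Γ(S, 𝒪_S)^* → Dist X` for `S` in `ℱ(X)`. -/
def Dist.of {X : KScheme k} (S : FiniteSub X) :
    Module.Dual k (Sections S.scheme) →ₗc[k] Dist X :=
  CoalgLimit.of (ι := FiniteSub X) (G := fun S => Module.Dual k (Sections S.scheme))
    (fun _ _ h => dualMap (Sections.map (FiniteSub.incl h))) S

theorem Dist.of_incl {X : KScheme k} {S T : FiniteSub X} (h : S ≤ T)
    (φ : Module.Dual k (Sections S.scheme)) :
    Dist.of T (dualMap (Sections.map (FiniteSub.incl h)) φ) = Dist.of S φ :=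
  CoalgLimit.of_map (ι := FiniteSub X) (G := fun S => Module.Dual k (Sections S.scheme)) _ h φ

/-- A morphism is scheme-theoretically dominant onto its image. -/
theorem ker_toImage {X Y : Scheme.{u}} (f : X ⟶ Y) [QuasiCompact f] :
    IsSchemeTheoreticallyDominant f.toImage := by
  constructor
  refine Scheme.IdealSheafData.ext_of_iSup_eq_top
    (fun U : Y.affineOpens => ⟨f.imageι ⁻¹ᵁ U.1, U.2.preimage f.imageι⟩) ?_ fun U => ?_
  · rw [← Scheme.Hom.preimage_iSup, iSup_affineOpens_eq_top, Scheme.Hom.preimage_top]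
  · rw [Scheme.Hom.ker_apply, Scheme.IdealSheafData.ideal_bot, Pi.bot_apply,
      ← RingHom.injective_iff_ker_eq_bot]
    exact f.toImage_app_injective U

theorem isArtinianScheme_of_isFinite (S : KScheme k) [IsFinite S.hom] :
    IsArtinianScheme S.left := by
  have : IsAffine S.left := isAffine_of_isAffineHom S.hom
  have hS : Module.Finite k (Sections S) := Sections.finite S inferInstance
  have hart : IsArtinianRing (Sections S) := IsArtinianRing.of_finite k _
  have : IsArtinianScheme (Spec Γ(S.left, ⊤)) := Scheme.isArtinianScheme_Spec.mpr hart
  have : IsLocallyArtinian S.left := .of_isImmersion S.left.isoSpec.hom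
  exact { }

/-- The scheme-theoretic image of a scheme finite over `k` is finite over `k`. -/
theorem isFinite_image {S Y : KScheme k} [IsFinite S.hom] (g : S ⟶ Y) :
    IsFinite (g.left.imageι ≫ Y.hom) := by
  have : IsArtinianScheme S.left := isArtinianScheme_of_isFinite S
  have : QuasiCompact g.left := ⟨fun U _ _ => (Set.toFinite _).isCompact⟩
  have := ker_toImage g.left
  have : QuasiCompact g.left.toImage := ⟨fun U _ _ => (Set.toFinite _).isCompact⟩
  have : IsLocallyArtinian g.left.image := by
    refine ⟨fun U => ?_⟩
    let V := g.left.toImage ⁻¹ᵁ U.1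
    have hV : IsClosedImmersion V.ι := .of_isPreimmersion _ (isClosed_discrete _)
    have hVf : IsFinite (V.ι ≫ S.hom) := inferInstance
    have h1 : Module.Finite k (Sections (Over.mk (V.ι ≫ S.hom))) := Sections.finite _ hVf
    let h : Over.mk (V.ι ≫ S.hom) ⟶ Over.mk (U.1.ι ≫ g.left.imageι ≫ Y.hom) :=
      Over.homMk (g.left.toImage ∣_ U.1) (by simp [V])
    have hinj : Function.Injective (Sections.map h) := by
      change Function.Injective (g.left.toImage ∣_ U.1).appTop
      have he := morphismRestrict_appTop g.left.toImage U.1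
      refine (congrArg (fun p => Function.Injective (ConcreteCategory.hom p)) he).mpr ?_
      exact (ConcreteCategory.bijective_of_isIso (S.left.presheaf.map
        (eqToHom (image_morphismRestrict_preimage g.left.toImage U.1 ⊤)).op)).1.comp
        (g.left.toImage.app_injective (U.1.ι ''ᵁ ⊤))
    have h2 : Module.Finite k (Sections (Over.mk (U.1.ι ≫ g.left.imageι ≫ Y.hom))) :=
      Module.Finite.of_injective (Sections.map h).toLinearMap hinj
    have h3 : IsArtinianRing (Sections (Over.mk (U.1.ι ≫ g.left.imageι ≫ Y.hom))) :=
      IsArtinianRing.of_finite k _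
    have h4 : IsArtinianRing Γ(U.1.toScheme, ⊤) := h3
    exact U.1.topIso.commRingCatIsoToRingEquiv.surjective.isArtinianRing
  have hsurj : Function.Surjective g.left.toImage := by
    have hd : DenseRange g.left.toImage := g.left.toImage.denseRange
    have := hd.closure_range
    rwa [(isClosed_discrete _).closure_eq, Set.range_eq_univ] at this
  have : Finite g.left.image := Finite.of_surjective _ hsurj
  have : IsAffine g.left.image := inferInstance
  let Z : KScheme k := Over.mk (g.left.imageι ≫ Y.hom)
  have : IsAffine Z.left := ‹IsAffine g.left.image›
  refine isFinite_of_affine Z ?_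
  let h : S ⟶ Z := Over.homMk g.left.toImage (by simp [Z])
  have hS : Module.Finite k (Sections S) := Sections.finite S inferInstance
  exact Module.Finite.of_injective (Sections.map h).toLinearMap (g.left.toImage.app_injective ⊤)

namespace FiniteSub

/-- The scheme-theoretic image in `Y` of a scheme `S` finite over `k`. -/
def image {S Y : KScheme k} [IsFinite S.hom] (g : S ⟶ Y) : FiniteSub Y :=
  ⟨g.left.ker, isFinite_image g⟩

/-- The morphism from `S` to its scheme-theoretic image. -/
def toImage {S Y : KScheme k} [IsFinite S.hom] (g : S ⟶ Y) : S ⟶ (image g).scheme :=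
  Over.homMk g.left.toImage (by
    change g.left.toImage ≫ g.left.imageι ≫ Y.hom = S.hom
    simp)

theorem toImage_ι {S Y : KScheme k} [IsFinite S.hom] (g : S ⟶ Y) : toImage g ≫ (image g).ι = g := by
  ext1
  exact g.left.toImage_imageι

theorem image_mono {X Y : KScheme k} (f : X ⟶ Y) {S T : FiniteSub X} (h : S ≤ T) :
    image (S.ι ≫ f) ≤ image (T.ι ≫ f) := by
  have h1 : incl h ≫ T.ι ≫ f = S.ι ≫ f := by rw [← Category.assoc, incl_ι]
  change (T.ι ≫ f).left.ker ≤ (S.ι ≫ f).left.ker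
  rw [← h1]
  exact Scheme.Hom.le_ker_comp (incl h).left (T.ι ≫ f).left

end FiniteSub

/-- Any two closed subschemes finite over `k` are contained in a third one. -/
instance (X : KScheme k) : IsDirectedOrder (FiniteSub X) where
  directed S T := by
    let g := Limits.coprod.desc S.1.subschemeι T.1.subschemeι
    have hg : g ≫ X.hom = Limits.coprod.desc (S.1.subschemeι ≫ X.hom) (T.1.subschemeι ≫ X.hom) := by
      ext1 <;> simp [g]
    have hS := S.2
    have hT := T.2
    let W : KScheme k := Over.mk (g ≫ X.hom)
    have : IsFinite W.hom := by
      change IsFinite (g ≫ X.hom)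
      rw [hg]
      infer_instance
    let g' : W ⟶ X := Over.homMk g rfl
    refine ⟨FiniteSub.image g', ?_, ?_⟩
    · have h : g.ker ≤ (Limits.coprod.inl ≫ g).ker := Scheme.Hom.le_ker_comp _ _
      rw [Limits.coprod.inl_desc, Scheme.IdealSheafData.ker_subschemeι] at h
      exact h
    · have h : g.ker ≤ (Limits.coprod.inr ≫ g).ker := Scheme.Hom.le_ker_comp _ _
      rw [Limits.coprod.inr_desc, Scheme.IdealSheafData.ker_subschemeι] at h
      exact h

instance (X : KScheme k) : Nonempty (FiniteSub X) :=
  ⟨⟨⊤, inferInstance⟩⟩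

/-- The functoriality of `Dist`: for `S` in `ℱ(X)` with scheme-theoretic image `S'` in `Y`, the map
`Γ(S, 𝒪_S)^* → Γ(S', 𝒪_S')^*` is the transpose of pullback along `S → S'`. -/
def Dist.map {X Y : KScheme k} (f : X ⟶ Y) : Dist X →ₗc[k] Dist Y :=
  CoalgLimit.lift _
    (fun S => (Dist.of (FiniteSub.image (S.ι ≫ f))).comp
      (dualMap (Sections.map (FiniteSub.toImage (S.ι ≫ f)))))
    (by
      intro S T h φ
      have hm := FiniteSub.image_mono f h
      refine Eq.trans ?_ (Dist.of_incl hm _)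
      refine congrArg (Dist.of (FiniteSub.image (T.ι ≫ f))) ?_
      have h1 : FiniteSub.incl h ≫ FiniteSub.toImage (T.ι ≫ f)
          = FiniteSub.toImage (S.ι ≫ f) ≫ FiniteSub.incl hm := by
        refine FiniteSub.hom_ext _ ?_
        rw [Category.assoc, Category.assoc, FiniteSub.toImage_ι, FiniteSub.incl_ι,
          FiniteSub.toImage_ι, ← Category.assoc, FiniteSub.incl_ι]
      have h2 : (Sections.map (FiniteSub.incl h)).comp (Sections.map (FiniteSub.toImage (T.ι ≫ f)))
          = (Sections.map (FiniteSub.toImage (S.ι ≫ f))).comp (Sections.map (FiniteSub.incl hm)) := by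
        rw [← Sections.map_comp, ← Sections.map_comp, h1]
      exact congrArg (fun p : Sections (FiniteSub.image (T.ι ≫ f)).scheme →ₐ[k] Sections S.scheme =>
        φ ∘ₗ p.toLinearMap) h2)

theorem Dist.map_of {X Y : KScheme k} (f : X ⟶ Y) (S : FiniteSub X)
    (φ : Module.Dual k (Sections S.scheme)) :
    Dist.map f (Dist.of S φ) = Dist.of (FiniteSub.image (S.ι ≫ f))
      (dualMap (Sections.map (FiniteSub.toImage (S.ι ≫ f))) φ) :=
  CoalgLimit.lift_of (ι := FiniteSub X) (G := fun S => Module.Dual k (Sections S.scheme)) _ _ _ S φ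

end Schemes
noncomputable section Points

variable {k : Type u} [Field k]

section Affine

theorem Dist.toFiniteDual_compat {X : KScheme k} {S T : FiniteSub X} (h : S ≤ T)
    (φ : Module.Dual k (Sections S.scheme)) :
    FiniteDual.ofDual (Sections.map T.ι) (dualMap (Sections.map (FiniteSub.incl h)) φ)
      = FiniteDual.ofDual (Sections.map S.ι) φ := by
  refine FiniteDual.incl_injective ?_
  have h2 : (Sections.map (FiniteSub.incl h)).comp (Sections.map T.ι) = Sections.map S.ι := by
    rw [← Sections.map_comp, FiniteSub.incl_ι]
  exact congrArg (fun p : Sections X →ₐ[k] Sections S.scheme => φ ∘ₗ p.toLinearMap) h2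

/-- The map `Dist X → Γ(X, 𝒪_X)°` that pulls back functionals along `Γ(X, 𝒪_X) → Γ(S, 𝒪_S)`. -/
def Dist.toFiniteDual (X : KScheme k) : Dist X →ₗc[k] FiniteDual k (Sections X) :=
  CoalgLimit.lift _ (fun S => FiniteDual.ofDual (Sections.map S.ι))
    fun _ _ h φ => Dist.toFiniteDual_compat h φ

theorem Dist.toFiniteDual_of (X : KScheme k) (S : FiniteSub X)
    (φ : Module.Dual k (Sections S.scheme)) :
    Dist.toFiniteDual X (Dist.of S φ) = FiniteDual.ofDual (Sections.map S.ι) φ :=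
  CoalgLimit.lift_of (ι := FiniteSub X) (G := fun S => Module.Dual k (Sections S.scheme)) _ _ _ S φ

theorem FiniteSub.map_ι_surjective {X : KScheme k} [IsAffine X.left] (S : FiniteSub X) :
    Function.Surjective (Sections.map S.ι) :=
  (IsClosedImmersion.isAffine_surjective_of_isAffine S.1.subschemeι).2

/-- For affine `X`, the map `Dist X → Γ(X, 𝒪_X)°` is bijective. -/
theorem Dist.toFiniteDual_bijective (X : KScheme k) [IsAffine X.left] :
    Function.Bijective (Dist.toFiniteDual X) := by
  constructor
  · refine CoalgLimit.liftₗ_injective (ι := FiniteSub X)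
      (G := fun S => Module.Dual k (Sections S.scheme)) _
      (fun S => (FiniteDual.ofDual (Sections.map S.ι)).toLinearMap)
      (fun _ _ h φ => Dist.toFiniteDual_compat h φ) fun S φ ψ h => ?_
    refine LinearMap.ext fun b => ?_
    obtain ⟨a, rfl⟩ := S.map_ι_surjective b
    exact LinearMap.congr_fun (congrArg (FiniteDual.incl k _) h) a
  · intro φ
    obtain ⟨I, hI, h⟩ := φ.incl_mem
    let J : X.left.IdealSheafData := .ofIdealTop I
    let Z : KScheme k := Over.mk (J.subschemeι ≫ X.hom)
    let i : Z ⟶ X := Over.homMk J.subschemeι rfl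
    have hZ := IsClosedImmersion.isAffine_surjective_of_isAffine J.subschemeι
    have : IsAffine Z.left := hZ.1
    have hsurj : Function.Surjective (Sections.map i) := hZ.2
    have hker : ∀ a : Sections X, Sections.map i a = 0 ↔ a ∈ I := fun a => by
      have h1 := J.ker_subschemeι_app ⟨⊤, isAffineOpen_top X.left⟩
      have h2 : J.ideal ⟨⊤, isAffineOpen_top X.left⟩ = I :=
        Scheme.IdealSheafData.equivOfIsAffine.apply_symm_apply I
      rw [h2] at h1
      exact (SetLike.ext_iff.mp h1 a)
    have hfin : Module.Finite k (Sections Z) :=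
      Module.Finite.of_surjective
        (Ideal.Quotient.liftₐ I (Sections.map i) fun a ha => (hker a).mpr ha).toLinearMap
        (Ideal.Quotient.lift_surjective_of_surjective I (fun a ha => (hker a).mpr ha) hsurj)
    let S : FiniteSub X := ⟨J, isFinite_of_affine Z hfin⟩
    have hφ : LinearMap.ker (Sections.map i).toLinearMap ≤ LinearMap.ker (FiniteDual.incl k _ φ) :=
      fun a ha => h a ((hker a).mp ha)
    have hmem : FiniteDual.incl k _ φ ∈ LinearMap.range (Sections.map i).toLinearMap.dualMap := by
      rw [LinearMap.range_dualMap_eq_dualAnnihilator_ker, Submodule.mem_dualAnnihilator]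
      exact fun a ha => hφ ha
    obtain ⟨ψ, hψ⟩ := hmem
    exact ⟨Dist.of S ψ, FiniteDual.incl_injective ((congrArg _ (Dist.toFiniteDual_of X S ψ)).trans hψ)⟩

variable (k) in
/-- `Spec A` as a `k`-scheme, for a commutative `k`-algebra `A`. -/
def specOver (A : Type u) [CommRing A] [Algebra k A] : KScheme k :=
  Over.mk (Spec.map (CommRingCat.ofHom (algebraMap k A)))

instance (A : Type u) [CommRing A] [Algebra k A] : IsAffine (specOver k A).left :=
  inferInstanceAs (IsAffine (Spec (CommRingCat.of A)))

variable (k) in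
/-- The isomorphism `A ≅ Γ(Spec A, 𝒪)`. -/
def sectionsSpecEquiv (A : Type u) [CommRing A] [Algebra k A] : A ≃ₐ[k] Sections (specOver k A) :=
  AlgEquiv.ofRingEquiv (f := (Scheme.ΓSpecIso (CommRingCat.of A)).symm.commRingCatIsoToRingEquiv)
    (fun c => congrArg (fun g => g.hom c)
      (Scheme.ΓSpecIso_inv_naturality (CommRingCat.ofHom (algebraMap k A))))

theorem FiniteDual.map_bijective {A B : Type*} [CommRing A] [Algebra k A] [CommRing B] [Algebra k B]
    (e : A ≃ₐ[k] B) : Function.Bijective (FiniteDual.map (k := k) e.toAlgHom) := by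
  refine ⟨fun φ ψ h => FiniteDual.incl_injective (LinearMap.ext fun b => ?_), fun φ => ?_⟩
  · have := LinearMap.congr_fun (congrArg (FiniteDual.incl k _) h) (e.symm b)
    change FiniteDual.incl k _ φ (e (e.symm b)) = FiniteDual.incl k _ ψ (e (e.symm b)) at this
    simpa using this
  · refine ⟨FiniteDual.map e.symm.toAlgHom φ, FiniteDual.incl_injective (LinearMap.ext fun a => ?_)⟩
    change FiniteDual.incl k _ φ (e.symm (e a)) = _
    simp

variable (k) in
/-- The isomorphism `Dist (Spec A) ≅ A°` of coalgebras. It sends the class of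
`φ : Γ(S, 𝒪_S) → k` to the composite of `φ` with `A → Γ(S, 𝒪_S)`. -/
def distSpecEquiv (A : Type u) [CommRing A] [Algebra k A] :
    Dist (specOver k A) ≃ₗc[k] FiniteDual k A :=
  CoalgEquiv.ofBijective
    (f := (FiniteDual.map (sectionsSpecEquiv k A).toAlgHom).comp (Dist.toFiniteDual (specOver k A)))
    ((FiniteDual.map_bijective (sectionsSpecEquiv k A)).comp
      (Dist.toFiniteDual_bijective (specOver k A)))

end Affine

/-- The local ring `𝒪_{X,x}`. -/
def LocalRing (X : KScheme k) (x : X.left) : Type u := X.left.presheaf.stalk x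

namespace LocalRing

instance (X : KScheme k) (x : X.left) : CommRing (LocalRing X x) :=
  inferInstanceAs (CommRing (X.left.presheaf.stalk x))

/-- The structure homomorphism `k → Γ(X, 𝒪_X) → 𝒪_{X,x}`. -/
def structureHom (X : KScheme k) (x : X.left) : CommRingCat.of k ⟶ X.left.presheaf.stalk x :=
  Sections.structureHom X ≫ X.left.presheaf.germ ⊤ x (TopologicalSpace.Opens.mem_top x)

instance (X : KScheme k) (x : X.left) : Algebra k (LocalRing X x) := (structureHom X x).hom.toAlgebra

theorem structureHom_comp {X Y : KScheme k} (f : X ⟶ Y) (x : X.left) :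
    structureHom Y (f.left x) ≫ f.left.stalkMap x = structureHom X x := by
  rw [structureHom, Category.assoc, Scheme.Hom.germ_stalkMap, structureHom,
    ← Sections.structureHom_comp f, Category.assoc]
  rfl

/-- The homomorphism `𝒪_{Y,f(x)} → 𝒪_{X,x}` induced by a morphism of `k`-schemes. -/
def map {X Y : KScheme k} (f : X ⟶ Y) (x : X.left) : LocalRing Y (f.left x) →ₐ[k] LocalRing X x where
  __ := (f.left.stalkMap x).hom
  commutes' c := congrArg (fun g => g.hom c) (structureHom_comp f x)

/-- The canonical morphism `Spec 𝒪_{X,x} → X` of `k`-schemes. -/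
def fromSpec (X : KScheme k) (x : X.left) : specOver k (LocalRing X x) ⟶ X :=
  Over.homMk (X.left.fromSpecStalk x) (by
    have h : X.left.fromSpecStalk x ≫ X.hom = Spec.map (structureHom X x) := by
      rw [← toSpecΓ_structureHom X, Scheme.fromSpecStalk_toSpecΓ_assoc, ← Spec.map_comp]
      rfl
    exact h)

end LocalRing

/-- The residue field `κ(x)`. -/
def ResField (X : KScheme k) (x : X.left) : Type u := X.left.residueField x

namespace ResField

instance (X : KScheme k) (x : X.left) : Field (ResField X x) :=
  inferInstanceAs (Field (X.left.residueField x))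

instance (X : KScheme k) (x : X.left) : Algebra k (ResField X x) :=
  (LocalRing.structureHom X x ≫ X.left.residue x).hom.toAlgebra

/-- The extension `κ(f(x)) → κ(x)` of residue fields induced by a morphism of `k`-schemes. -/
def map {X Y : KScheme k} (f : X ⟶ Y) (x : X.left) : ResField Y (f.left x) →ₐ[k] ResField X x where
  __ := (f.left.residueFieldMap x).hom
  commutes' c := congrArg (fun g => g.hom c) (show (LocalRing.structureHom Y (f.left x) ≫
      Y.left.residue (f.left x)) ≫ f.left.residueFieldMap x
        = LocalRing.structureHom X x ≫ X.left.residue x by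
    rw [Category.assoc, Scheme.residue_residueFieldMap, ← Category.assoc,
      LocalRing.structureHom_comp])

end ResField

/-- The set `fin(X)` of the points `x` with `[κ(x) : k] < ∞`. -/
def finPoints (X : KScheme k) : Set X.left := {x | Module.Finite k (ResField X x)}

theorem map_mem_finPoints {X Y : KScheme k} (f : X ⟶ Y) {x : X.left} (hx : x ∈ finPoints X) :
    f.left x ∈ finPoints Y :=
  have : Module.Finite k (ResField X x) := hx
  Module.Finite.of_injective (ResField.map f x).toLinearMap (ResField.map f x).toRingHom.injective

/-- The coalgebra `Dist(X, x) = (𝒪_{X,x})°` of distributions supported at `x`. -/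
abbrev DistAt (X : KScheme k) (x : X.left) : Type u := FiniteDual k (LocalRing X x)

/-- The coalgebra homomorphism `Dist(X, x) = (𝒪_{X,x})° ≅ Dist(Spec 𝒪_{X,x}) → Dist(X)` induced by
the canonical morphism `Spec 𝒪_{X,x} → X`. -/
def DistAt.toDist (X : KScheme k) (x : X.left) : DistAt X x →ₗc[k] Dist X :=
  (Dist.map (LocalRing.fromSpec X x)).comp (distSpecEquiv k (LocalRing X x)).symm

/-- The direct sum of coalgebras `⨁ Dist(X, x)` over the points `x` of a set `P`. -/
abbrev DistSum (X : KScheme k) (P : Set X.left) : Type u :=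
  CoalgSum k fun x : P => DistAt X x.1

/-- The coalgebra homomorphism `⨁ Dist(X, x) → Dist(X)` induced by the canonical morphisms
`Spec 𝒪_{X,x} → X`. -/
def DistSum.toDist (X : KScheme k) (P : Set X.left) : DistSum X P →ₗc[k] Dist X :=
  CoalgSum.lift fun x : P => DistAt.toDist X x.1

/-- For a morphism `f : X → Y` of `k`-schemes, the homomorphism
`⨁_{x ∈ fin(X)} Dist(X, x) → ⨁_{y ∈ fin(Y)} Dist(Y, y)` whose restriction to `Dist(X, x)` is the map
`Dist(X, x) → Dist(Y, f(x))` dual to `𝒪_{Y,f(x)} → 𝒪_{X,x}`. -/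
def DistSum.map {X Y : KScheme k} (f : X ⟶ Y) :
    DistSum X (finPoints X) →ₗc[k] DistSum Y (finPoints Y) :=
  CoalgSum.lift fun x : finPoints X =>
    (CoalgSum.of k (fun y : finPoints Y => DistAt Y y.1) ⟨f.left x.1, map_mem_finPoints f x.2⟩).comp
      (FiniteDual.map (LocalRing.map f x.1))

end Points

end SchemeDist

open SchemeDist

/-! A closed subscheme `S` of `X` finite over `k` is affine and artinian, so its space is finite and
discrete. Germs at its points may be prescribed freely and determine a section: `Γ(S, 𝒪_S)` is the
product of the finite-dimensional local rings of `S`. Dually, a functional on `Γ(S, 𝒪_S)` is a sum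
of functionals that each factor through one local ring. The theorem is this decomposition, passed to
the limit over `S`.

Surjectivity (`Dist.mem_span_toDist`): the class of a functional on `S` is the image under `S → X`
of a distribution on `S`, which splits by `exists_eq_sum_germ`. Naturality (`DistAt.toDist_map`)
carries the summand at `s` into the image of `Dist(X, x)`, where `x` is the image of `s`, and `x`
has finite residue field because `s` does.

Injectivity (`DistSum.toDist_injective`): finitely many local distributions are represented by
functionals `θ x` on one common `S`, and the value of `θ x` at a section depends only on its germs
over `x` (`DistAt.exists_toDist_eq`). If the sum vanishes in `Dist X`, it vanishes as a functional
on `S` (`Dist.of_injective`). Testing it on sections with a prescribed germ over one point and zero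
germs elsewhere kills each summand.

Naturality rests on `Dist.map_comp` and the commutative square of the morphisms `Spec 𝒪_{X,x} → X`.
For the closed points, a point with finite residue field is closed, and at any other point the local
ring has no proper ideal of finite codimension, so its finite dual is zero. -/

namespace SchemeDist

/-! ### Functoriality of `Dist` and naturality of the local homomorphisms -/

noncomputable section Functoriality

variable {k : Type u} [Field k]

/-- The class of a functional on the global sections of a finite `k`-scheme pushed forward along a
morphism can be computed on any finite closed subscheme through which the morphism factors. -/
theorem Dist.of_image {W X : KScheme k} [IsFinite W.hom] (g : W ⟶ X) (S : FiniteSub X)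
    (h : W ⟶ S.scheme) (hg : h ≫ S.ι = g) (φ : Module.Dual k (Sections W)) :
    haveI := Sections.finite W inferInstance
    Dist.of (FiniteSub.image g) (dualMap (Sections.map (FiniteSub.toImage g)) φ)
      = Dist.of S (dualMap (Sections.map h) φ) := by
  have := Sections.finite W inferInstance
  -- The scheme-theoretic image is the smallest closed subscheme through which `g` factors.
  have hle : FiniteSub.image g ≤ S := by
    change S.1 ≤ g.left.ker
    rw [← hg]
    have := Scheme.Hom.le_ker_comp h.left S.ι.left
    exact (Scheme.IdealSheafData.ker_subschemeι S.1).symm.le.trans this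
  rw [← Dist.of_incl hle]
  refine congrArg (Dist.of S) ?_
  have h1 : FiniteSub.toImage g ≫ FiniteSub.incl hle = h :=
    FiniteSub.hom_ext _ (by rw [Category.assoc, FiniteSub.incl_ι, FiniteSub.toImage_ι, hg])
  rw [← h1, Sections.map_comp]
  rfl

theorem Dist.hom_ext {X : KScheme k} {C : Type*} [AddCommGroup C] [Module k C] [Coalgebra k C]
    {p q : Dist X →ₗc[k] C}
    (h : ∀ (S : FiniteSub X) (φ : Module.Dual k (Sections S.scheme)),
      p (Dist.of S φ) = q (Dist.of S φ)) : p = q := by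
  refine CoalgHom.ext fun d => ?_
  obtain ⟨S, φ, rfl⟩ := CoalgLimit.exists_of (ι := FiniteSub X)
    (G := fun S => Module.Dual k (Sections S.scheme)) _ d
  exact h S φ

theorem Dist.exists_of {X : KScheme k} (d : Dist X) :
    ∃ (S : FiniteSub X) (φ : Module.Dual k (Sections S.scheme)), Dist.of S φ = d :=
  CoalgLimit.exists_of (ι := FiniteSub X) (G := fun S => Module.Dual k (Sections S.scheme)) _ d

/-- The two sides use the image of `S` in `Z` and the image of the image of `S` in `Y`. These need
not be compared: `S` maps to the second one compatibly with its map to `Z`, so `Dist.of_image`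
applies. -/
theorem Dist.map_comp {X Y Z : KScheme k} (f : X ⟶ Y) (g : Y ⟶ Z) :
    Dist.map (f ≫ g) = (Dist.map g).comp (Dist.map f) := by
  refine Dist.hom_ext fun S φ => ?_
  rw [CoalgHom.comp_apply, Dist.map_of, Dist.map_of, Dist.map_of]
  refine (Dist.of_image _ _
    (FiniteSub.toImage (S.ι ≫ f) ≫ FiniteSub.toImage ((FiniteSub.image (S.ι ≫ f)).ι ≫ g)) ?_ φ).trans ?_
  · rw [Category.assoc, FiniteSub.toImage_ι, ← Category.assoc, FiniteSub.toImage_ι, Category.assoc]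
  · rw [Sections.map_comp]
    rfl

theorem Dist.toFiniteDual_map {X Y : KScheme k} (f : X ⟶ Y) (d : Dist X) :
    Dist.toFiniteDual Y (Dist.map f d) = FiniteDual.map (Sections.map f) (Dist.toFiniteDual X d) := by
  obtain ⟨S, φ, rfl⟩ := Dist.exists_of d
  rw [Dist.map_of, Dist.toFiniteDual_of, Dist.toFiniteDual_of]
  refine FiniteDual.incl_injective ?_
  have h2 : (Sections.map (FiniteSub.toImage (S.ι ≫ f))).comp
      (Sections.map (FiniteSub.image (S.ι ≫ f)).ι) = (Sections.map S.ι).comp (Sections.map f) := by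
    rw [← Sections.map_comp, FiniteSub.toImage_ι, Sections.map_comp]
  exact congrArg (fun p : Sections Y →ₐ[k] Sections S.scheme => φ ∘ₗ p.toLinearMap) h2

variable (k) in
/-- The morphism of spectra induced by a homomorphism of `k`-algebras. -/
def specOver.map {A B : Type u} [CommRing A] [Algebra k A] [CommRing B] [Algebra k B]
    (f : A →ₐ[k] B) : specOver k B ⟶ specOver k A :=
  Over.homMk (Spec.map (CommRingCat.ofHom f.toRingHom)) (by
    change Spec.map _ ≫ Spec.map _ = Spec.map _
    rw [← Spec.map_comp, ← CommRingCat.ofHom_comp]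
    congr 2
    exact f.comp_algebraMap)

theorem sectionsSpecEquiv_naturality {A B : Type u} [CommRing A] [Algebra k A] [CommRing B]
    [Algebra k B] (f : A →ₐ[k] B) (a : A) :
    Sections.map (specOver.map k f) (sectionsSpecEquiv k A a) = sectionsSpecEquiv k B (f a) :=
  (congrArg (fun g => g.hom a)
    (Scheme.ΓSpecIso_inv_naturality (CommRingCat.ofHom f.toRingHom))).symm

theorem distSpecEquiv_map {A B : Type u} [CommRing A] [Algebra k A] [CommRing B]
    [Algebra k B] (f : A →ₐ[k] B) (d : Dist (specOver k B)) :
    distSpecEquiv k A (Dist.map (specOver.map k f) d) = FiniteDual.map f (distSpecEquiv k B d) := by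
  change FiniteDual.map (sectionsSpecEquiv k A).toAlgHom (Dist.toFiniteDual _ (Dist.map _ d)) =
    FiniteDual.map f (FiniteDual.map (sectionsSpecEquiv k B).toAlgHom (Dist.toFiniteDual _ d))
  rw [Dist.toFiniteDual_map]
  refine FiniteDual.incl_injective (LinearMap.ext fun a => ?_)
  exact congrArg (FiniteDual.incl k _ (Dist.toFiniteDual _ d)) (sectionsSpecEquiv_naturality f a)

/-- `DistAt.toDist` is built from the inverse isomorphism, so naturality is needed in this
direction. -/
theorem distSpecEquiv_symm_map {A B : Type u} [CommRing A] [Algebra k A] [CommRing B]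
    [Algebra k B] (f : A →ₐ[k] B) (ψ : FiniteDual k B) :
    (distSpecEquiv k A).symm (FiniteDual.map f ψ)
      = Dist.map (specOver.map k f) ((distSpecEquiv k B).symm ψ) := by
  obtain ⟨d, rfl⟩ : ∃ d, distSpecEquiv k B d = ψ := ⟨_, (distSpecEquiv k B).apply_symm_apply ψ⟩
  rw [← distSpecEquiv_map]
  simp

theorem LocalRing.map_fromSpec {X Y : KScheme k} (f : X ⟶ Y) (x : X.left) :
    specOver.map k (LocalRing.map f x) ≫ fromSpec Y (f.left x) = fromSpec X x ≫ f := by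
  ext1
  exact Scheme.SpecMap_stalkMap_fromSpecStalk f.left (x := x)

/-- Naturality of the homomorphisms `Dist(X, x) → Dist(X)`. -/
theorem DistAt.toDist_map {X Y : KScheme k} (f : X ⟶ Y) (x : X.left) (ψ : DistAt X x) :
    DistAt.toDist Y (f.left x) (FiniteDual.map (LocalRing.map f x) ψ)
      = Dist.map f (DistAt.toDist X x ψ) := by
  change Dist.map _ ((distSpecEquiv k _).symm _) = Dist.map f (Dist.map _ _)
  rw [distSpecEquiv_symm_map, ← CoalgHom.comp_apply, ← Dist.map_comp, LocalRing.map_fromSpec,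
    Dist.map_comp]
  rfl

theorem DistSum.toDist_of (X : KScheme k) (P : Set X.left) (x : P) (ψ : DistAt X x.1) :
    DistSum.toDist X P (CoalgSum.of k (fun x : P => DistAt X x.1) x ψ) = DistAt.toDist X x.1 ψ :=
  CoalgSum.lift_of (G := fun x : P => DistAt X x.1) _ x ψ

theorem DistSum.toDist_naturality {X Y : KScheme k} (f : X ⟶ Y) :
    (DistSum.toDist Y (finPoints Y)).comp (DistSum.map f)
      = (Dist.map f).comp (DistSum.toDist X (finPoints X)) := by
  refine CoalgHom.ext fun d => LinearMap.congr_fun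
    (f := ((DistSum.toDist Y (finPoints Y)).comp (DistSum.map f)).toLinearMap)
    (g := ((Dist.map f).comp (DistSum.toDist X (finPoints X))).toLinearMap)
    (CoalgSum.hom_extₗ fun x => LinearMap.ext fun ψ => ?_) d
  change DistSum.toDist Y _ (DistSum.map f (CoalgSum.of k _ x ψ))
    = Dist.map f (DistSum.toDist X _ (CoalgSum.of k _ x ψ))
  rw [DistSum.toDist_of, DistSum.map, CoalgSum.lift_of]
  exact (DistSum.toDist_of _ _ _ _).trans (DistAt.toDist_map f x.1 ψ)

/-- The germ of global sections, as a homomorphism of `k`-algebras. -/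
def LocalRing.germ (X : KScheme k) (x : X.left) : Sections X →ₐ[k] LocalRing X x where
  __ := (X.left.presheaf.germ ⊤ x (TopologicalSpace.Opens.mem_top x)).hom
  commutes' _ := rfl

/-- On global sections `Spec 𝒪_{X,x} → X` is the germ map. For affine `X`, where `Dist.toFiniteDual`
is bijective, this reduces identities between local distributions to identities of functionals on
`Γ(X, 𝒪_X)`. -/
theorem DistAt.toFiniteDual_toDist (X : KScheme k) (x : X.left) (ψ : DistAt X x) :
    Dist.toFiniteDual X (DistAt.toDist X x ψ) = FiniteDual.map (LocalRing.germ X x) ψ := by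
  obtain ⟨d, rfl⟩ : ∃ d, distSpecEquiv k (LocalRing X x) d = ψ :=
    ⟨_, (distSpecEquiv k (LocalRing X x)).apply_symm_apply ψ⟩
  have h1 : DistAt.toDist X x (distSpecEquiv k _ d) = Dist.map (LocalRing.fromSpec X x) d :=
    congrArg (Dist.map (LocalRing.fromSpec X x)) ((distSpecEquiv k _).symm_apply_apply d)
  rw [h1, Dist.toFiniteDual_map]
  refine FiniteDual.incl_injective (LinearMap.ext fun a => ?_)
  refine congrArg (FiniteDual.incl k _ (Dist.toFiniteDual _ d)) ?_
  have := congrArg (fun g => g.hom a) (Scheme.fromSpecStalk_appTop (X := X.left) (x := x))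
  refine Eq.trans this ?_
  -- What remains is the restriction from `⊤` to `⊤`, which is the identity.
  exact congrArg (fun p => p.hom (sectionsSpecEquiv k (LocalRing X x) (LocalRing.germ X x a)))
    ((Spec (X.left.presheaf.stalk x)).presheaf.map_id (.op ⊤))

end Functoriality
-- Sections and germs
section Germs

/-- On a scheme with discrete underlying space, germs at the points may be prescribed freely. -/
theorem exists_germ_eq_of_discrete (S : Scheme.{u}) [DiscreteTopology S]
    (t : ∀ s : S, S.presheaf.stalk s) :
    ∃ b : Γ(S, ⊤), ∀ s, S.presheaf.germ ⊤ s (TopologicalSpace.Opens.mem_top s) b = t s := by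
  let U : S → S.Opens := fun s => ⟨{s}, isOpen_discrete _⟩
  have hU : ∀ s, s ∈ U s := fun s => rfl
  -- The singleton is the smallest open neighbourhood of `s`, so every germ at `s` is represented on
  -- it.
  have key : ∀ s : S, ∃ f : Γ(S, U s), S.presheaf.germ (U s) s (hU s) f = t s := fun s => by
    obtain ⟨V, hV, f, hf⟩ := S.presheaf.exists_germ_eq (t s)
    have hle : U s ≤ V := by rintro _ rfl; exact hV
    exact ⟨S.presheaf.map (homOfLE hle).op f,
      (S.presheaf.germ_res_apply (homOfLE hle) s (hU s) f).trans hf⟩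
  choose f hf using key
  obtain ⟨b, hb, -⟩ := S.sheaf.existsUnique_gluing' U ⊤ (fun s => homOfLE le_top)
    (fun s _ => TopologicalSpace.Opens.mem_iSup.mpr ⟨s, rfl⟩) f fun i j => by
      -- Two singletons coincide or are disjoint; in the second case there are no germs to compare
      -- on the overlap.
      by_cases h : i = j
      · subst h; rfl
      · refine TopCat.Presheaf.section_ext S.sheaf _ _ _ ?_
        rintro x ⟨rfl, rfl⟩
        exact (h rfl).elim
  refine ⟨b, fun s => ?_⟩
  rw [← hf s, ← hb s]
  exact (S.presheaf.germ_res_apply (homOfLE le_top) s (hU s) b).symm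

theorem germ_app_congr {W X : Scheme.{u}} {p q : W ⟶ X} (e : p = q) (U : X.Opens) (f : Γ(X, U)) (w : W)
    (hp : p w ∈ U) (hq : q w ∈ U) :
    W.presheaf.germ (p ⁻¹ᵁ U) w hp (p.app U f) = W.presheaf.germ (q ⁻¹ᵁ U) w hq (q.app U f) := by
  subst e; rfl

/-- If a morphism `W → X` factors both through `S` and through `Spec 𝒪_{X,x}`, then a section of
`S` with the same germs as `f` pulls back to the same section of `W` as the germ of `f` at `x`. -/
theorem app_eq_app_of_germ_eq {W S X : Scheme.{u}} {x : X} (h : W ⟶ S) (i : S ⟶ X)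
    (j : W ⟶ Spec (X.presheaf.stalk x)) (e : h ≫ i = j ≫ X.fromSpecStalk x) (U : X.Opens)
    (hx : x ∈ U) (f : Γ(X, U)) (b : Γ(S, ⊤)) (hU : ∀ w, i (h w) ∈ U)
    (hb : ∀ w, S.presheaf.germ ⊤ (h w) (TopologicalSpace.Opens.mem_top _) b
      = S.presheaf.germ (i ⁻¹ᵁ U) (h w) (hU w) (i.app U f)) :
    h.appTop b = j.appTop ((Scheme.ΓSpecIso (X.presheaf.stalk x)).inv (X.presheaf.germ U x hx f)) := by
  -- Sections of `W` are compared germ by germ. At `w` both germs turn out to be that of the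
  -- pullback of `f` along the common morphism `W → X`.
  refine TopCat.Presheaf.section_ext W.sheaf ⊤ _ _ fun w _ => ?_
  have hU' : (X.fromSpecStalk x) (j w) ∈ U := by
    have := hU w
    rw [← Scheme.Hom.comp_apply, e] at this
    exact this
  have h1 := Scheme.Hom.germ_stalkMap_apply h ⊤ w trivial b
  have h2 := Scheme.Hom.germ_stalkMap_apply h (i ⁻¹ᵁ U) w (hU w) (i.app U f)
  have h3 := germ_app_congr e U f w (hU w) hU'
  have h4 := Scheme.Hom.germ_stalkMap_apply j (X.fromSpecStalk x ⁻¹ᵁ U) w hU'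
    ((X.fromSpecStalk x).app U f)
  have h5 := Scheme.Hom.germ_stalkMap_apply j ⊤ w trivial
    ((Scheme.ΓSpecIso (X.presheaf.stalk x)).inv (X.presheaf.germ U x hx f))
  -- The pullback of `f` to `Spec 𝒪_{X,x}` is the restriction of the global section given by the
  -- germ of `f` at `x`.
  have h6 : (Spec (X.presheaf.stalk x)).presheaf.germ (X.fromSpecStalk x ⁻¹ᵁ U) (j w) hU'
      ((X.fromSpecStalk x).app U f) = (Spec (X.presheaf.stalk x)).presheaf.germ ⊤ (j w) trivial
      ((Scheme.ΓSpecIso (X.presheaf.stalk x)).inv (X.presheaf.germ U x hx f)) := by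
    have h7 := congrArg (fun g => g.hom f) (Scheme.fromSpecStalk_app (X := X) hx)
    refine (congrArg _ h7).trans ?_
    exact (Spec (X.presheaf.stalk x)).presheaf.germ_res_apply (homOfLE le_top) _ hU' _
  refine h1.symm.trans ?_
  refine Eq.trans ?_ h5
  rw [← h6]
  refine Eq.trans ?_ h4.symm
  refine Eq.trans ?_ h3
  refine Eq.trans ?_ h2
  exact congrArg _ (hb w)

end Germs

/-! ### Finite closed subschemes inside the direct limit -/

noncomputable section Decomposition

variable {k : Type u} [Field k]

instance (S : KScheme k) [IsFinite S.hom] : IsArtinianScheme S.left := isArtinianScheme_of_isFinite S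

instance {X : KScheme k} (S : FiniteSub X) : IsClosedImmersion S.ι.left :=
  inferInstanceAs (IsClosedImmersion S.1.subschemeι)

/-- A functional on a closed subscheme is determined by its class in `Dist X`. -/
theorem Dist.of_injective {X : KScheme k} (S : FiniteSub X) :
    Function.Injective (Dist.of S) := by
  classical
  intro φ ψ h
  have : DirectedSystem (fun S : FiniteSub X => Module.Dual k (Sections S.scheme))
      (fun _ _ h => (dualMap (Sections.map (FiniteSub.incl h))).toLinearMap) := by
    refine ⟨fun S φ => ?_, fun R S T hRS hST φ => ?_⟩
    · have h1 : FiniteSub.incl (le_refl S) = 𝟙 _ := FiniteSub.hom_ext _ (by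
        rw [FiniteSub.incl_ι, Category.id_comp])
      refine LinearMap.ext fun a => congrArg φ ?_
      rw [h1]; rfl
    · have h1 : FiniteSub.incl hRS ≫ FiniteSub.incl hST = FiniteSub.incl (hRS.trans hST) :=
        FiniteSub.hom_ext _ (by simp only [Category.assoc, FiniteSub.incl_ι])
      refine LinearMap.ext fun a => congrArg φ ?_
      rw [← h1, Sections.map_comp]; rfl
  -- Elements that agree in a directed limit agree at some stage `T`. The transition map to `T` is
  -- injective, as the transpose of the surjection on sections along the closed immersion `S → T` of
  -- affine schemes.
  obtain ⟨T, hT, h⟩ := Module.DirectLimit.exists_eq_of_of_eq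
    (G := fun S : FiniteSub X => Module.Dual k (Sections S.scheme))
    (f := fun _ _ h => (dualMap (Sections.map (FiniteSub.incl h))).toLinearMap)
    (i := S) (x := φ) (y := ψ) h
  have : IsAffine T.scheme.left := isAffine_of_isAffineHom T.scheme.hom
  have : IsClosedImmersion (FiniteSub.incl hT).left := by
    have h1 : (FiniteSub.incl hT).left ≫ T.ι.left = S.ι.left :=
      congrArg CommaMorphism.left (FiniteSub.incl_ι hT)
    have : IsClosedImmersion ((FiniteSub.incl hT).left ≫ T.ι.left) := by
      rw [h1]; infer_instance
    exact .of_comp _ T.ι.left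
  refine LinearMap.ext fun b => ?_
  obtain ⟨a, rfl⟩ := (IsClosedImmersion.isAffine_surjective_of_isAffine (FiniteSub.incl hT).left).2 b
  exact LinearMap.congr_fun h a

/-! ### Splitting of finite schemes and surjectivity -/

theorem LocalRing.germ_surjective (S : KScheme k) [IsFinite S.hom] (s : S.left) :
    Function.Surjective (germ S s) := fun t => by
  classical
  obtain ⟨b, hb⟩ := exists_germ_eq_of_discrete S.left (Function.update 0 s t)
  exact ⟨b, (hb s).trans (Function.update_self ..)⟩

/-- The residue map, as a homomorphism of `k`-algebras. -/
def LocalRing.residue (X : KScheme k) (x : X.left) : LocalRing X x →ₐ[k] ResField X x where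
  __ := (X.left.residue x).hom
  commutes' _ := rfl

theorem LocalRing.residue_surjective (X : KScheme k) (x : X.left) :
    Function.Surjective (residue X x) :=
  X.left.residue_surjective x

/-- The residue field is a quotient of the local ring, hence of the finite-dimensional algebra `Γ(S,
𝒪_S)`. -/
theorem mem_finPoints_of_isFinite (S : KScheme k) [IsFinite S.hom] (s : S.left) :
    s ∈ finPoints S :=
  have := Sections.finite S inferInstance
  Module.Finite.of_surjective ((LocalRing.residue S s).comp (LocalRing.germ S s)).toLinearMap
    ((LocalRing.residue_surjective S s).comp (LocalRing.germ_surjective S s))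

/-- A finite `k`-scheme is the disjoint union of the spectra of its local rings, so every
functional on its global sections is a sum of functionals on the local rings. -/
theorem exists_eq_sum_germ (S : KScheme k) [IsFinite S.hom] (φ : FiniteDual k (Sections S)) :
    ∃ ψ : ∀ s, DistAt S s, haveI := Fintype.ofFinite S.left
      φ = ∑ s, FiniteDual.map (LocalRing.germ S s) (ψ s) := by
  classical
  have := Sections.finite S inferInstance
  have hfin : ∀ s, Module.Finite k (LocalRing S s) := fun s =>
    Module.Finite.of_surjective (LocalRing.germ S s).toLinearMap (LocalRing.germ_surjective S s)
  let := Fintype.ofFinite S.left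
  let j : Sections S →ₗ[k] (∀ s, LocalRing S s) := LinearMap.pi fun s => (LocalRing.germ S s).toLinearMap
  have hj : LinearMap.ker j = ⊥ := LinearMap.ker_eq_bot.mpr fun a b h =>
    TopCat.Presheaf.section_ext S.left.sheaf ⊤ a b fun s _ => congrFun h s
  -- Injectivity of the map to the product is enough: over a field it has a linear retraction `r`,
  -- along which `φ` extends to the product. The extension `χ` is then restricted to the factors.
  obtain ⟨r, hr⟩ := j.exists_leftInverse_of_injective hj
  let χ : Module.Dual k (∀ s, LocalRing S s) := FiniteDual.incl k _ φ ∘ₗ r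
  refine ⟨fun s => ⟨χ ∘ₗ LinearMap.single k _ s, mem_finiteDual_of_finite _⟩, ?_⟩
  refine FiniteDual.incl_injective (LinearMap.ext fun a => ?_)
  rw [map_sum, LinearMap.sum_apply]
  have h1 : ∑ s, Pi.single s (j a s) = j a := Finset.univ_sum_single (j a)
  have h2 : r (j a) = a := LinearMap.congr_fun hr a
  calc FiniteDual.incl k _ φ a = χ (j a) := by simp only [χ, LinearMap.comp_apply, h2]
    _ = ∑ s, χ (Pi.single s (j a s)) := by rw [← map_sum, h1]
    _ = _ := rfl

/-- The decomposition takes place on a finite closed subscheme `S` carrying `d`, and is pushed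
forward to `X` by naturality. -/
theorem Dist.mem_span_toDist (X : KScheme k) (d : Dist X) :
    d ∈ ⨆ x : finPoints X, LinearMap.range (DistAt.toDist X x.1).toLinearMap := by
  obtain ⟨S, φ, rfl⟩ := Dist.exists_of d
  have : IsAffine S.scheme.left := isAffine_of_isAffineHom S.scheme.hom
  let := Fintype.ofFinite S.scheme.left
  obtain ⟨ψ, hψ⟩ := exists_eq_sum_germ S.scheme ⟨φ, mem_finiteDual_of_finite φ⟩
  obtain ⟨d, hd⟩ := (Dist.toFiniteDual_bijective S.scheme).2 ⟨φ, mem_finiteDual_of_finite φ⟩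
  have h1 : d = ∑ s, DistAt.toDist S.scheme s (ψ s) := by
    apply (Dist.toFiniteDual_bijective S.scheme).1
    rw [hd, hψ, map_sum]
    exact Finset.sum_congr rfl fun s _ => (DistAt.toFiniteDual_toDist _ _ _).symm
  -- The distribution on `S` is represented by some `χ` on a closed `T` in `S`; by the choice of
  -- `d`, pulling `χ` back to `Γ(S, 𝒪_S)` gives `φ`.
  have h2 : Dist.map S.ι d = Dist.of S φ := by
    obtain ⟨T, χ, rfl⟩ := Dist.exists_of d
    rw [Dist.map_of]
    refine (Dist.of_image (T.ι ≫ S.ι) S T.ι rfl χ).trans (congrArg (Dist.of S) ?_)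
    rw [Dist.toFiniteDual_of] at hd
    exact congrArg (FiniteDual.incl k _) hd
  rw [← h2, h1, map_sum]
  refine Submodule.sum_mem _ fun s _ => ?_
  rw [← DistAt.toDist_map]
  exact Submodule.mem_iSup_of_mem
    (⟨S.ι.left s, map_mem_finPoints S.ι (mem_finPoints_of_isFinite S.scheme s)⟩ : finPoints X)
    ⟨_, rfl⟩

/-- A general index set `P` serves both `fin(X)` and the set of closed points. -/
theorem DistSum.toDist_surjective (X : KScheme k) {P : Set X.left} (hP : finPoints X ⊆ P) :
    Function.Surjective (DistSum.toDist X P) := fun d => by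
  have h := Dist.mem_span_toDist X d
  have : ⨆ x : finPoints X, LinearMap.range (DistAt.toDist X x.1).toLinearMap
      ≤ LinearMap.range (DistSum.toDist X P).toLinearMap := by
    refine iSup_le fun x => ?_
    rintro _ ⟨ψ, rfl⟩
    exact ⟨_, DistSum.toDist_of X P ⟨x.1, hP x.2⟩ ψ⟩
  exact this h

/-! ### Support at a point and injectivity -/

theorem FiniteSub.isClosed_point {X : KScheme k} (S : FiniteSub X) (s : S.scheme.left) :
    IsClosed {S.ι.left s} := by
  have h := S.ι.left.isClosedEmbedding.isClosedMap {s} (isClosed_discrete _)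
  rwa [Set.image_singleton] at h

/-- The class of a distribution at `x` on a large closed subscheme: it only depends
on germs at the point over `x`. -/
theorem DistAt.exists_toDist_eq (X : KScheme k) {x : X.left} (ψ : DistAt X x) :
    ∃ S₀ : FiniteSub X, ∀ S, S₀ ≤ S → ∃ θ : Module.Dual k (Sections S.scheme),
      DistAt.toDist X x ψ = Dist.of S θ ∧
      ∀ (U : X.left.Opens) (hx : x ∈ U) (f : Γ(X.left, U)) (b : Sections S.scheme),
        (∀ s (hs : S.ι.left s = x), S.scheme.left.presheaf.germ ⊤ s trivial b
          = S.scheme.left.presheaf.germ (S.ι.left ⁻¹ᵁ U) s (show S.ι.left s ∈ U from hs ▸ hx)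
            (S.ι.left.app U f)) →
        θ b = FiniteDual.incl k _ ψ (X.left.presheaf.germ U x hx f) := by
  obtain ⟨d, rfl⟩ : ∃ d, distSpecEquiv k (LocalRing X x) d = ψ :=
    ⟨_, (distSpecEquiv k (LocalRing X x)).apply_symm_apply ψ⟩
  obtain ⟨W, φ, rfl⟩ := Dist.exists_of d
  let g := W.ι ≫ LocalRing.fromSpec X x
  -- The distribution lives on a finite closed subscheme `W` of `Spec 𝒪_{X,x}`, and `S₀` is the
  -- image of `W` in `X`. Allowing every larger `S` lets finitely many points share one `S`.
  refine ⟨FiniteSub.image g, fun S hS => ?_⟩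
  let h := FiniteSub.toImage g ≫ FiniteSub.incl hS
  have hg : h ≫ S.ι = g := by
    rw [Category.assoc, FiniteSub.incl_ι, FiniteSub.toImage_ι]
  refine ⟨dualMap (Sections.map h) φ, ?_, fun U hx f b hb => ?_⟩
  · rw [← Dist.of_image g S h hg]
    refine (congrArg (Dist.map (LocalRing.fromSpec X x))
      ((distSpecEquiv k _).symm_apply_apply _)).trans ?_
    rw [Dist.map_of]
  · have he : h.left ≫ S.ι.left = W.ι.left ≫ X.left.fromSpecStalk x :=
      congrArg CommaMorphism.left hg
    -- Points in the image of `Spec 𝒪_{X,x}` specialize to `x`, while points of `S` are closed in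
    -- `X`; so all of `W` lies over `x`.
    have hpt : ∀ w, S.ι.left (h.left w) = x := fun w => by
      have h1 : S.ι.left (h.left w) ⤳ x := by
        rw [← Scheme.Hom.comp_apply, he]
        have : X.left.fromSpecStalk x (W.ι.left w) ∈ Set.range (X.left.fromSpecStalk x) := ⟨_, rfl⟩
        rwa [Scheme.range_fromSpecStalk] at this
      exact (Set.mem_singleton_iff.mp (h1.mem_closed (S.isClosed_point (h.left w)) rfl)).symm
    have key := app_eq_app_of_germ_eq h.left S.ι.left W.ι.left he U hx f b
      (fun w => by rw [hpt w]; exact hx) fun w => hb _ (hpt w)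
    have hd : FiniteDual.incl k _ (distSpecEquiv k (LocalRing X x) (Dist.of W φ))
        = φ ∘ₗ (Sections.map W.ι).toLinearMap ∘ₗ (sectionsSpecEquiv k (LocalRing X x)).toLinearMap :=
      congrArg (fun ψ => FiniteDual.incl k _
        (FiniteDual.map (sectionsSpecEquiv k (LocalRing X x)).toAlgHom ψ)) (Dist.toFiniteDual_of _ W φ)
    rw [hd]
    exact congrArg φ key

open scoped Classical in
theorem DistSum.toDist_apply (X : KScheme k) (P : Set X.left) (d : Π₀ x : P, DistAt X x.1) :
    DistSum.toDist X P d = ∑ x ∈ d.support, DistAt.toDist X x.1 (d x) := by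
  have h : (d : DistSum X P) = ∑ x ∈ d.support, CoalgSum.of k (fun x : P => DistAt X x.1) x (d x) := by
    conv_lhs => rw [← DFinsupp.sum_single (f := d)]
    refine Finset.sum_congr rfl fun x _ => ?_
    -- The two sides differ only in the decidability instance for equality on `P`.
    change DFinsupp.single x (d x) =
      @DFinsupp.single P (fun x => DistAt X x.1) _ (fun _ _ => Classical.propDecidable _) x (d x)
    congr!
  conv_lhs => rw [h]
  rw [map_sum]
  exact Finset.sum_congr rfl fun x _ => DistSum.toDist_of X P x _

/-- Functionals supported at distinct points of a discrete scheme are independent, since sections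
with prescribed germs separate them. -/
theorem DistSum.toDist_injective (X : KScheme k) (P : Set X.left) :
    Function.Injective (DistSum.toDist X P) := by
  classical
  refine (injective_iff_map_eq_zero (DistSum.toDist X P)).mpr fun d hd => ?_
  let d' : Π₀ x : P, DistAt X x.1 := d
  have hd' := (DistSum.toDist_apply X P d').symm.trans hd
  choose S₀ hS₀ using fun x : P => DistAt.exists_toDist_eq X (d' x)
  -- Finite closed subschemes form a directed set, so one `S` works for the whole support.
  obtain ⟨S, hS⟩ := (d'.support.image S₀).exists_le
  choose! θ hθ hθ' using fun x hx => hS₀ x S (hS _ (Finset.mem_image_of_mem S₀ hx))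
  have hsum : ∑ x ∈ d'.support, θ x = 0 := by
    apply Dist.of_injective S
    rw [map_sum, map_zero, ← hd']
    exact Finset.sum_congr rfl fun x hx => (hθ x hx).symm
  refine DFinsupp.ext (β := fun x : P => DistAt X x.1) (f := d') (g := 0) fun x => ?_
  by_contra hx
  have hxs : x ∈ d'.support := DFinsupp.mem_support_iff.mpr hx
  refine hx (FiniteDual.incl_injective (LinearMap.ext fun a => ?_))
  obtain ⟨U, hxU, f, rfl⟩ := X.left.presheaf.exists_germ_eq a
  -- The test section has the germ of `f` over `x` and germ zero at all other points of `S`, so only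
  -- the summand at `x` sees it.
  obtain ⟨(b : Sections S.scheme), hb⟩ := exists_germ_eq_of_discrete S.scheme.left fun s =>
    if hs : S.ι.left s = x.1 then S.scheme.left.presheaf.germ (S.ι.left ⁻¹ᵁ U) s
      (show S.ι.left s ∈ U from hs ▸ hxU) (S.ι.left.app U f) else 0
  have h1 := LinearMap.congr_fun hsum b
  rw [LinearMap.sum_apply, Finset.sum_eq_single_of_mem x hxs] at h1
  · rw [← hθ' x hxs U hxU f b fun s hs => by rw [hb, dif_pos hs]]
    exact h1
  · intro y hy hyx
    -- Over `y ≠ x` the test section has the germs of the zero section of `X`.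
    refine (hθ' y hy ⊤ trivial 0 b fun s hs => ?_).trans ((congrArg _ (map_zero _)).trans
      (map_zero (FiniteDual.incl k _ (d' y))))
    rw [hb, dif_neg fun h => hyx (Subtype.ext (hs.symm.trans h)), map_zero, map_zero]

/-! ### Points with finite residue field, and the theorem -/

/-- `Spec κ(x)` is finite over `k`, so its scheme-theoretic image is a finite closed subscheme of
`X` through `x`, and the points of such a subscheme are closed in `X`. -/
theorem finPoints_subset_closedPoints (X : KScheme k) : finPoints X ⊆ closedPoints X.left := by
  intro x hx
  let Z : KScheme k := Over.mk (X.left.fromSpecResidueField x ≫ X.hom)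
  let g : Z ⟶ X := Over.homMk (X.left.fromSpecResidueField x) rfl
  have hZ : Z.hom = Spec.map (LocalRing.structureHom X x ≫ X.left.residue x) := by
    rw [Spec.map_comp, LocalRing.structureHom, Spec.map_comp, ← Scheme.fromSpecStalk_toSpecΓ_assoc,
      toSpecΓ_structureHom]
    simp [Z, Scheme.fromSpecResidueField]
  have : IsFinite Z.hom := by
    rw [hZ]
    exact (IsFinite.SpecMap_iff _).mpr hx
  let z : Spec (X.left.residueField x) := IsLocalRing.closedPoint _
  have h := (FiniteSub.image g).isClosed_point ((FiniteSub.toImage g).left z)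
  rw [← Scheme.Hom.comp_apply, ← Over.comp_left, FiniteSub.toImage_ι] at h
  have hx : g.left z = x := X.left.fromSpecResidueField_apply x z
  rw [hx] at h
  exact mem_closedPoints_iff.mpr h

/-- A proper ideal `I` of the local ring lies in the maximal ideal, so `κ(x)` is a quotient of
`𝒪_{X,x} / I`. Finite codimension of `I` would make `κ(x)` finite over `k`; hence only the unit
ideal has finite codimension. -/
theorem DistAt.subsingleton (X : KScheme k) (x : X.left) (hx : x ∉ finPoints X) :
    Subsingleton (DistAt X x) := by
  refine subsingleton_of_forall_eq 0 fun φ => FiniteDual.incl_injective (LinearMap.ext fun a => ?_)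
  obtain ⟨I, hI, h⟩ := φ.incl_mem
  by_cases hI' : I = ⊤
  · exact h a (hI' ▸ trivial)
  have : IsLocalRing (LocalRing X x) := inferInstanceAs (IsLocalRing (X.left.presheaf.stalk x))
  have hle : ∀ b ∈ I, LocalRing.residue X x b = 0 := fun b hb =>
    (IsLocalRing.residue_eq_zero_iff b).mpr (IsLocalRing.le_maximalIdeal hI' hb)
  exact (hx (Module.Finite.of_surjective (Ideal.Quotient.liftₐ I (LocalRing.residue X x) hle).toLinearMap
    (Ideal.Quotient.lift_surjective_of_surjective I hle (LocalRing.residue_surjective X x)))).elim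

end Decomposition
end SchemeDist

open SchemeDist
theorem mainTheorem12 (k : Type u) [Field k] :
    ∃ e : ∀ X : KScheme k, DistSum X (finPoints X) ≃ₗc[k] Dist X,
      (∀ X : KScheme k, (e X).toCoalgHom = DistSum.toDist X (finPoints X)) ∧
      (∀ (X Y : KScheme k) (f : X ⟶ Y),
        (e Y).toCoalgHom.comp (DistSum.map f) = (Dist.map f).comp (e X).toCoalgHom) ∧
      (∀ X : KScheme k, finPoints X ⊆ closedPoints X.left) ∧
      (∀ (X : KScheme k) (x : X.left), x ∉ finPoints X → Subsingleton (DistAt X x)) ∧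
      (∀ X : KScheme k, Function.Bijective (DistSum.toDist X (closedPoints X.left))) := by
  refine ⟨fun X => CoalgEquiv.ofBijective (f := DistSum.toDist X (finPoints X))
    ⟨DistSum.toDist_injective X _, DistSum.toDist_surjective X le_rfl⟩, fun X => rfl,
    fun X Y f => DistSum.toDist_naturality f, finPoints_subset_closedPoints, DistAt.subsingleton,
    -- For the closed points bijectivity suffices, as the inverse of a bijective coalgebra
    -- homomorphism is again one.
    fun X => ⟨DistSum.toDist_injective X _,
      DistSum.toDist_surjective X (finPoints_subset_closedPoints X)⟩⟩
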